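/- Let $p,q\ge 0$ with $0<p+q\le 1$. Consider the planar motion $(X(t),Y(t))$ that starts at the origin and moves with speed $c>0$ along the directions $d_j=(\cos\frac{\pi j}{2},\sin\frac{\pi j}{2})$, $j\in\mathbb{Z}/4$. The initial direction is uniform on the four directions. The direction changes at the arrivals of a Poisson process of rate $\lambda>0$, and at each arrival $d_j$ is replaced by $d_{j+1}$ with probability $p$, by $d_{j-1}$ with probability $q$ and by $d_{j+2}$ with probability $1-p-q$, all these choices being independent. Let $D(t)$ be the direction at time $t$ and let $T(t)=\int_0^t \mathbf 1_{\{D(\tau)\in\{d_1,d_3\}\}}\,d\tau$ be the time spent moving vertically. Put $$\begin{aligned}L_{\lambda,c}={}&\Big[\big(\tfrac{\partial}{\partial t}+\lambda\big)^2-\lambda^2(1-p-q)^2\Big]\Big[\big(\tfrac{\partial}{\partial t}+\lambda+\tfrac{\partial}{\partial s}\big)^2-c^2\tfrac{\partial^2}{\partial y^2}\Big]-4\lambda^2pq\big(\tfrac{\partial}{\partial t}+\lambda\big)\big(\tfrac{\partial}{\partial t}+\lambda+\tfrac{\partial}{\partial s}\big)\\&-4\lambda^3(1-p-q)(p^2+q^2)\big(\tfrac{\partial}{\partial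 t}+\lambda+\tfrac12\tfrac{\partial}{\partial s}\big)-\lambda^2(1-p-q)^2\big(\tfrac{\partial}{\partial t}+\lambda\big)^2-\lambda^4(p^2-q^2)^2\\&-4\lambda^4pq(1-p-q)^2+\lambda^4(1-p-q)^4 ,\end{aligned}\qquad \sigma=\frac14\,\frac{(1-p)+(1-q)}{(1-p)^2+(1-q)^2}.$$ Let $\lambda_n>0$ and $c_n>0$ be sequences with $\lambda_n\to+\infty$, $c_n\to+\infty$ and $\lambda_n/c_n^2\to1$, and for each $n$ let $T_n,Y_n$ be the processes $T,Y$ of a motion with parameters $\lambda_n,c_n,p,q$. Convergence of distributions below means convergence on every test function. Then: 1. For every open $U\subseteq\mathbb{R}^3$ (variables $(s,y,t)$) and all distributions $v_n\to u$ on $U$, we have $\lambda_n^{-3}L_{\lambda_n,c_n}v_n\to 4(p+q)\big((1-p)^2+(1-q)^2\big)\Big(\frac{\partial u}{\partial t}+\frac12\frac{\partial u}{\partial s}-\sigma\frac{\partial^2u}{\partial y^2}\Big)$. 2. In particular the equation $L_{\lambda,c}\bar u=0$ becomes $$\frac{\partial u}{\partial t}=-\frac12\frac{\partial u}{\partial s}+\sigma\,\frac{\partial^2u}{\partial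 y^2}\qquad(\ast)$$ in the limit: if $L_{\lambda_n,c_n}v_n=0$ on $U$ for all $n$ and $v_n\to u$, then $u$ satisfies $(\ast)$. 3. The joint density $\bar u_n(s,y,t)\,ds\,dy=\mathbb{P}(T_n(t)\in ds,\,Y_n(t)\in dy)$, understood as a distribution on $\{t>0\}$ that includes the singular parts of the law, satisfies $L_{\lambda_n,c_n}\bar u_n=0$, and $\bar u_n$ converges to the distribution $u=\delta\big(s-\tfrac t2\big)\,\dfrac{e^{-y^2/(4\sigma t)}}{\sqrt{4\pi\sigma t}}$, which satisfies $(\ast)$. 4. For every $t>0$, $T_n(t)\to t/2$ in probability: in the limit, half of the time is spent moving vertically. 5. For every $t>0$, $(T_n(t),Y_n(t))$ converges in distribution to $(t/2,Z_t)$, where $Z_t$ is Gaussian with mean $0$ and variance $2\sigma t$. -/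

import Mathlib

open MeasureTheory ProbabilityTheory Filter Topology Set TopologicalSpace
open LineDeriv
open scoped Distributions

noncomputable section

/-- The random data driving the planar motion, on a probability space `(Ω, P)`.
The four directions `d_j = (cos (π j / 2), sin (π j / 2))` are indexed by `j : ZMod 4`.
* `D₀` is the initial direction, uniform on the four directions;
* `gap k` is the waiting time between the `k`-th and the `(k+1)`-st change of direction; the gaps
  are i.i.d. exponential of rate `lam`, so that the changes of direction are the arrivals of a
  Poisson process of intensity `lam`;
* `turn k` is the increment of the index of the direction at the `(k+1)`-st change: `1`
  (counter-clockwise) with probability `p`, `-1` (clockwise) with probability `q`, and `2`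
  (reflection) with probability `1 - p - q`.
All these random variables are mutually independent. -/
structure PlanarMotion {Ω : Type*} [MeasurableSpace Ω] (P : Measure Ω) (lam p q : ℝ) where
  D₀ : Ω → ZMod 4
  gap : ℕ → Ω → ℝ
  turn : ℕ → Ω → ZMod 4
  measurable_D₀ : Measurable D₀
  measurable_gap : ∀ k, Measurable (gap k)
  measurable_turn : ∀ k, Measurable (turn k)
  law_D₀ : ∀ j, P.real {ω | D₀ ω = j} = 1 / 4
  law_gap : ∀ k, P.map (gap k) = expMeasure lam
  law_turn_ccw : ∀ k, P.real {ω | turn k ω = 1} = p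
  law_turn_cw : ∀ k, P.real {ω | turn k ω = -1} = q
  law_turn_reflect : ∀ k, P.real {ω | turn k ω = 2} = 1 - p - q
  indep_gap_turn : ∀ k, IndepFun (gap k) (turn k) P
  indep_steps : iIndepFun (fun k ω => (gap k ω, turn k ω)) P
  indep_D₀ : IndepFun D₀ (fun ω k => (gap k ω, turn k ω)) P

namespace PlanarMotion

variable {Ω : Type*} [MeasurableSpace Ω] {P : Measure Ω} {lam p q : ℝ}

/-- `N(t)`: the number of changes of direction up to time `t`. -/
def N (M : PlanarMotion P lam p q) (t : ℝ) (ω : Ω) : ℕ :=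
  {n : ℕ | ∑ k ∈ Finset.range (n + 1), M.gap k ω ≤ t}.ncard

/-- `D(t)`: the (index of the) direction of the motion at time `t`. -/
def D (M : PlanarMotion P lam p q) (t : ℝ) (ω : Ω) : ZMod 4 :=
  M.D₀ ω + ∑ k ∈ Finset.range (M.N t ω), M.turn k ω

/-- `X(t)`: the horizontal coordinate at time `t` of the motion with speed `c`. -/
def X (M : PlanarMotion P lam p q) (c t : ℝ) (ω : Ω) : ℝ :=
  ∫ τ in (0 : ℝ)..t, c * Real.cos (Real.pi / 2 * ((M.D τ ω).val : ℝ))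

/-- `Y(t)`: the vertical coordinate at time `t` of the motion with speed `c`. -/
def Y (M : PlanarMotion P lam p q) (c t : ℝ) (ω : Ω) : ℝ :=
  ∫ τ in (0 : ℝ)..t, c * Real.sin (Real.pi / 2 * ((M.D τ ω).val : ℝ))

/-- `T(t)`: the time spent moving vertically up to time `t`. -/
def T (M : PlanarMotion P lam p q) (t : ℝ) (ω : Ω) : ℝ :=
  ∫ τ in (0 : ℝ)..t, ({τ : ℝ | M.D τ ω = 1 ∨ M.D τ ω = 3}.indicator (fun _ => (1 : ℝ)) τ)

end PlanarMotion

/-- `∂/∂s` on distributions in the variables `(s, y, t)`. -/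
def Ds (U : Opens (ℝ × ℝ × ℝ)) : Module.End ℝ 𝓓'(U, ℝ) :=
  (lineDerivOpCLM ℝ 𝓓'(U, ℝ) ((1, 0, 0) : ℝ × ℝ × ℝ)).toLinearMap

/-- `∂/∂y` on distributions in the variables `(s, y, t)`. -/
def Dy (U : Opens (ℝ × ℝ × ℝ)) : Module.End ℝ 𝓓'(U, ℝ) :=
  (lineDerivOpCLM ℝ 𝓓'(U, ℝ) ((0, 1, 0) : ℝ × ℝ × ℝ)).toLinearMap

/-- `∂/∂t` on distributions in the variables `(s, y, t)`. -/
def Dt (U : Opens (ℝ × ℝ × ℝ)) : Module.End ℝ 𝓓'(U, ℝ) :=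
  (lineDerivOpCLM ℝ 𝓓'(U, ℝ) ((0, 0, 1) : ℝ × ℝ × ℝ)).toLinearMap

/-- The fourth-order differential operator `{…}` of the equation `{…} ū = 0` governing the joint
density of `(T(t), Y(t))`. Products are compositions. -/
def jointOp (U : Opens (ℝ × ℝ × ℝ)) (lam c p q : ℝ) : Module.End ℝ 𝓓'(U, ℝ) :=
  let A : Module.End ℝ 𝓓'(U, ℝ) := Dt U + lam • 1
  let B : Module.End ℝ 𝓓'(U, ℝ) := Dt U + lam • 1 + Ds U
  (A ^ 2 - (lam ^ 2 * (1 - p - q) ^ 2) • 1) * (B ^ 2 - c ^ 2 • Dy U ^ 2)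
    - (4 * lam ^ 2 * p * q) • (A * B)
    - (4 * lam ^ 3 * (1 - p - q) * (p ^ 2 + q ^ 2)) • (A + (1 / 2 : ℝ) • Ds U)
    - (lam ^ 2 * (1 - p - q) ^ 2) • A ^ 2
    - (lam ^ 4 * (p ^ 2 - q ^ 2) ^ 2) • 1
    - (4 * lam ^ 4 * p * q * (1 - p - q) ^ 2) • 1
    + (lam ^ 4 * (1 - p - q) ^ 4) • 1

/-- The coefficient of `∂²u/∂y²` in the limiting equation. -/
def diffCoeff (p q : ℝ) : ℝ :=
  1 / 4 * (((1 - p) + (1 - q)) / ((1 - p) ^ 2 + (1 - q) ^ 2))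

/-- The limiting equation `∂u/∂t = -½ ∂u/∂s + diffCoeff p q · ∂²u/∂y²`. -/
def LimitEq (U : Opens (ℝ × ℝ × ℝ)) (p q : ℝ) (u : 𝓓'(U, ℝ)) : Prop :=
  Dt U u = -((1 / 2 : ℝ) • Ds U u) + diffCoeff p q • Dy U (Dy U u)

/-- The set of the `(s, y, t)` with `t > 0`. -/
def halfSpace : Opens (ℝ × ℝ × ℝ) :=
  ⟨{x | 0 < x.2.2}, isOpen_lt continuous_const (continuous_snd.comp continuous_snd)⟩

/-- `u` is the joint density of `(T(t), Y(t))`, `t > 0`, as a distribution in `(s, y, t)`: it is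
`ℙ(T(t) ∈ ds, Y(t) ∈ dy) dt`, the singular parts of the law included. -/
def IsJointDensity {Ω : Type*} [MeasurableSpace Ω] {P : Measure Ω} {lam p q : ℝ}
    (M : PlanarMotion P lam p q) (c : ℝ) (u : 𝓓'(halfSpace, ℝ)) : Prop :=
  ∀ φ : 𝓓(halfSpace, ℝ), u φ = ∫ t in Ioi (0 : ℝ), ∫ ω, φ (M.T t ω, M.Y c t ω, t) ∂P

/-- The law of the limit of `Y(t)`: centred Gaussian with variance `2 · diffCoeff p q · t`. -/
def limitLaw (p q t : ℝ) : Measure ℝ := gaussianReal 0 (2 * diffCoeff p q * t).toNNReal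

instance (p q t : ℝ) : IsProbabilityMeasure (limitLaw p q t) := by
  unfold limitLaw; infer_instance

end

/-!
Everything probabilistic rests on Dynkin's formula for the piecewise linear Markov process
`(D(t), (T(t), Y(t), t))` (`PlanarMotion.dynkin`): for functions `F j` of the space-time point,
indexed by the direction `j`, the expectation of `F (D(t)) (T(t), Y(t), t)` grows at the rate of the
expectation of the generator, the derivative of `F j` along the velocity in direction `j` plus the
mean jump of `F` at rate `lam`. It is proved piece by piece: along a linear piece of the path it is
the fundamental theorem of calculus, an exponential waiting time turns an integral along the piece
into `lam⁻¹` times a value at its end (`PlanarMotion.integral_occ`), and the pieces telescope.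

*The equation of the joint density* (`jointOp_eq_zero`). The derivatives commute, so minus the
generator is a `4 × 4` matrix over a commutative ring, and its determinant is the transposed
fourth-order operator. The adjugate of this matrix, applied to the vector with all four components
equal to a test function `φ`, gives test functions `F j` (`exists_adjugate`) on which minus the
generator is, whatever the direction, the transposed fourth-order operator applied to `φ`. Since
test functions on the half space vanish at time `0` and for large times, Dynkin's formula says that
the joint density annihilates that function.

*The limit of the operator* (`tendsto_jointOp`). Expanding the operator by powers of `lam`, with
`c ^ 2` counted as `lam`, the terms of order `lam ^ 4` cancel, and those of order `lam ^ 3` are the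
limiting operator (`jointPoly_expansion`). Tested against `φ`, the operator is a combination, with
convergent coefficients, of finitely many fixed derivatives of `φ`, on each of which `v n`
converges.

*The limit of the process* (`PlanarMotion.tendsto_integral_cexp`). The function
`exp (i (α s + β y) - μ t)` is perturbed by a factor `1 + k j` depending on the direction, with
`k j` of order `c / lam` and chosen such that the generator of the perturbed function is small
(`PlanarMotion.generator_corrector`). This forces `μ = i α / 2 - σ β ^ 2 c ^ 2 / lam`, where `σ` is
`diffCoeff p q`. By Dynkin's formula the characteristic function of `(T(t), Y(t))` at `(α, β)` is
`exp (μ t)` up to a vanishing error, and Lévy's continuity theorem gives the convergence in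
distribution. Convergence in probability of `T(t)` is a consequence, because its limit is
deterministic, and so is the convergence of the joint densities, by dominated convergence in `t`.
-/

noncomputable section

/-! ### Transposes of operators on distributions -/

/-- Three commuting elements of an algebra lie in the image of a commutative algebra, so that
polynomial identities between them can be checked in a commutative ring. -/
lemma exists_commRing_algHom {A : Type*} [Ring A] [Algebra ℝ A] (a b c : A)
    (hab : Commute a b) (hac : Commute a c) (hbc : Commute b c) :
    ∃ (s : Subalgebra ℝ A) (_ : IsMulCommutative s) (a' b' c' : s),
      (a' : A) = a ∧ (b' : A) = b ∧ (c' : A) = c := by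
  have hcomm : ∀ x ∈ ({a, b, c} : Set A), ∀ y ∈ ({a, b, c} : Set A), x * y = y * x := by
    rintro x (rfl | rfl | rfl) y (rfl | rfl | rfl) <;>
      first | rfl | exact hab.eq | exact hab.eq.symm | exact hac.eq | exact hac.eq.symm
            | exact hbc.eq | exact hbc.eq.symm
  exact ⟨Algebra.adjoin ℝ {a, b, c}, Algebra.isMulCommutative_adjoin ℝ hcomm,
    ⟨a, Algebra.subset_adjoin (by simp)⟩, ⟨b, Algebra.subset_adjoin (by simp)⟩,
    ⟨c, Algebra.subset_adjoin (by simp)⟩, rfl, rfl, rfl⟩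

section TestOperators

variable {U : Opens (ℝ × ℝ × ℝ)}

/-- The derivative of a test function along `v`, as a linear operator. -/
def testDeriv (U : Opens (ℝ × ℝ × ℝ)) (v : ℝ × ℝ × ℝ) : Module.End ℝ 𝓓(U, ℝ) :=
  (lineDerivOpCLM ℝ 𝓓(U, ℝ) v).toLinearMap

lemma testDeriv_apply (v : ℝ × ℝ × ℝ) (φ : 𝓓(U, ℝ)) (x : ℝ × ℝ × ℝ) :
    testDeriv U v φ x = fderiv ℝ φ x v := by
  change (TestFunction.lineDerivCLM ℝ v φ : 𝓓(U, ℝ)) x = _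
  rw [TestFunction.lineDerivCLM_eq_fderivCLM, TestFunction.fderivCLM_apply_of_le _ (by simp)]

lemma testDeriv_commute (v w : ℝ × ℝ × ℝ) : Commute (testDeriv U v) (testDeriv U w) := by
  refine LinearMap.ext fun φ => TestFunction.ext fun x => ?_
  have hd : ContDiff ℝ 2 φ := φ.contDiff.of_le (WithTop.coe_le_coe.2 (le_top : (2 : ℕ∞) ≤ ⊤))
  have key : ∀ v w : ℝ × ℝ × ℝ, testDeriv U v (testDeriv U w φ) x
      = fderiv ℝ (fderiv ℝ φ) x v w := by
    intro v w
    rw [testDeriv_apply]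
    have : ((testDeriv U w φ : 𝓓(U, ℝ)) : ℝ × ℝ × ℝ → ℝ) = fun x => fderiv ℝ φ x w :=
      funext fun x => testDeriv_apply w φ x
    rw [this, fderiv_clm_apply ((hd.fderiv_right (m := 1) (by norm_num)).differentiable
      (by norm_num) x) (differentiableAt_const _)]
    simp
  change testDeriv U v (testDeriv U w φ) x = testDeriv U w (testDeriv U v φ) x
  rw [key, key]
  exact (hd.contDiffAt.isSymmSndFDerivAt (by simp)).eq v w

/-- `A` is the transpose of the operator `D` on distributions. -/
def IsTransposeOf (A : Module.End ℝ 𝓓(U, ℝ)) (D : Module.End ℝ 𝓓'(U, ℝ)) : Prop :=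
  ∀ (u : 𝓓'(U, ℝ)) (φ : 𝓓(U, ℝ)), D u φ = u (A φ)

namespace IsTransposeOf

variable {A B : Module.End ℝ 𝓓(U, ℝ)} {D E : Module.End ℝ 𝓓'(U, ℝ)}

lemma add (hA : IsTransposeOf A D) (hB : IsTransposeOf B E) : IsTransposeOf (A + B) (D + E) := by
  intro u φ
  simp [← hA u φ, ← hB u φ]

lemma sub (hA : IsTransposeOf A D) (hB : IsTransposeOf B E) : IsTransposeOf (A - B) (D - E) := by
  intro u φ
  simp [← hA u φ, ← hB u φ]

lemma smul (hA : IsTransposeOf A D) (k : ℝ) : IsTransposeOf (k • A) (k • D) := by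
  intro u φ
  simp [← hA u φ]

lemma one : IsTransposeOf (1 : Module.End ℝ 𝓓(U, ℝ)) 1 := fun _ _ => rfl

lemma mul (hA : IsTransposeOf A D) (hB : IsTransposeOf B E) : IsTransposeOf (B * A) (D * E) := by
  intro u φ
  simp only [Module.End.mul_apply]
  rw [hA, hB]

lemma pow (hA : IsTransposeOf A D) (n : ℕ) : IsTransposeOf (A ^ n) (D ^ n) := by
  induction n with
  | zero => simpa using one
  | succ n ih => rw [pow_succ, pow_succ']; exact hA.mul ih

end IsTransposeOf

/-- The transpose of `∂/∂v` is `-∂/∂v`. -/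
lemma isTransposeOf_lineDeriv (v : ℝ × ℝ × ℝ) :
    IsTransposeOf (-testDeriv U v) (lineDerivOpCLM ℝ 𝓓'(U, ℝ) v).toLinearMap := by
  intro u φ
  exact Distribution.lineDerivOp_apply_apply u φ v

/-- The polynomial defining the fourth-order operator, evaluated at `s`, `y`, `t` in place of
`∂/∂s`, `∂/∂y`, `∂/∂t`. -/
def jointPoly {R : Type*} [Ring R] [Algebra ℝ R] (s y t : R) (lam c p q : ℝ) : R :=
  ((t + lam • 1) ^ 2 - (lam ^ 2 * (1 - p - q) ^ 2) • 1) * ((t + lam • 1 + s) ^ 2 - c ^ 2 • y ^ 2)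
    - (4 * lam ^ 2 * p * q) • ((t + lam • 1) * (t + lam • 1 + s))
    - (4 * lam ^ 3 * (1 - p - q) * (p ^ 2 + q ^ 2)) • (t + lam • 1 + (1 / 2 : ℝ) • s)
    - (lam ^ 2 * (1 - p - q) ^ 2) • (t + lam • 1) ^ 2
    - (lam ^ 4 * (p ^ 2 - q ^ 2) ^ 2) • 1
    - (4 * lam ^ 4 * p * q * (1 - p - q) ^ 2) • 1
    + (lam ^ 4 * (1 - p - q) ^ 4) • 1

/-- The transpose of the fourth-order operator, acting on test functions. -/
def jointTestOp (U : Opens (ℝ × ℝ × ℝ)) (lam c p q : ℝ) : Module.End ℝ 𝓓(U, ℝ) :=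
  jointPoly (-testDeriv U (1, 0, 0)) (-testDeriv U (0, 1, 0)) (-testDeriv U (0, 0, 1)) lam c p q

/-- `jointTestOp` is the transpose of `jointOp`. The transposition reverses products; this is
harmless as derivatives of test functions commute. -/
lemma isTransposeOf_jointTestOp (lam c p q : ℝ) :
    IsTransposeOf (jointTestOp U lam c p q) (jointOp U lam c p q) := by
  have hs : IsTransposeOf (-testDeriv U (1, 0, 0)) (Ds U) := isTransposeOf_lineDeriv _
  have hy : IsTransposeOf (-testDeriv U (0, 1, 0)) (Dy U) := isTransposeOf_lineDeriv _
  have ht : IsTransposeOf (-testDeriv U (0, 0, 1)) (Dt U) := isTransposeOf_lineDeriv _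
  have hA := ht.add (IsTransposeOf.one.smul lam)
  have hB := hA.add hs
  have h1 := ((hA.pow 2).sub (IsTransposeOf.one.smul (lam ^ 2 * (1 - p - q) ^ 2))).mul
    ((hB.pow 2).sub ((hy.pow 2).smul (c ^ 2)))
  have key := (((((h1.sub ((hA.mul hB).smul (4 * lam ^ 2 * p * q))).sub
    ((hA.add (hs.smul (1 / 2))).smul (4 * lam ^ 3 * (1 - p - q) * (p ^ 2 + q ^ 2)))).sub
    ((hA.pow 2).smul (lam ^ 2 * (1 - p - q) ^ 2))).sub
    (IsTransposeOf.one.smul (lam ^ 4 * (p ^ 2 - q ^ 2) ^ 2))).sub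
    (IsTransposeOf.one.smul (4 * lam ^ 4 * p * q * (1 - p - q) ^ 2))).add
    (IsTransposeOf.one.smul (lam ^ 4 * (1 - p - q) ^ 4))
  change IsTransposeOf _ (jointPoly (Ds U) (Dy U) (Dt U) lam c p q)
  convert key using 1
  swap
  · rfl
  have c1 : Commute (-testDeriv U (0, 0, 1)) (-testDeriv U (1, 0, 0)) :=
    (testDeriv_commute _ _).neg_left.neg_right
  have c2 : Commute (-testDeriv U (0, 0, 1)) (-testDeriv U (0, 1, 0)) :=
    (testDeriv_commute _ _).neg_left.neg_right
  unfold jointTestOp jointPoly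
  generalize -testDeriv U (0, 0, 1) = t at *
  generalize -testDeriv U (0, 1, 0) = y at *
  generalize -testDeriv U (1, 0, 0) = s at *
  have one_l : ∀ (k : ℝ) (x : Module.End ℝ 𝓓(U, ℝ)), Commute (k • (1 : Module.End ℝ 𝓓(U, ℝ))) x :=
    fun k x => (Commute.one_left x).smul_left k
  have cAB : Commute (t + lam • 1) (t + lam • 1 + s) :=
    (Commute.refl _).add_right (c1.add_left (one_l _ _))
  have cAy : Commute (t + lam • 1) y := c2.add_left (one_l _ _)
  have c3 : Commute ((t + lam • 1) ^ 2 - (lam ^ 2 * (1 - p - q) ^ 2) • 1)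
      ((t + lam • 1 + s) ^ 2 - c ^ 2 • y ^ 2) :=
    ((cAB.pow_pow _ _).sub_right ((cAy.pow_pow _ _).smul_right _)).sub_left (one_l _ _)
  rw [c3.eq, cAB.eq]

end TestOperators

/-! ### The fourth-order operator in the limit -/

lemma sq_one_sub_add_sq_one_sub_pos {p q : ℝ} (hpq : p + q ≤ 1) :
    0 < (1 - p) ^ 2 + (1 - q) ^ 2 := by
  nlinarith [sq_nonneg (p - q)]

/-- The polynomial of the fourth-order operator, by decreasing powers of `lam`, when `c ^ 2` is
counted as `lam`. The terms of order `lam ^ 4` cancel. -/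
lemma jointPoly_expansion {R : Type*} [CommRing R] [Algebra ℝ R] (s y t : R) (lam c p q : ℝ) :
    jointPoly s y t lam c p q =
      lam ^ 3 • (2 * ((p + q) * ((1 - p) ^ 2 + (1 - q) ^ 2))) • ((2 : ℝ) • t + s)
      - (lam ^ 2 * c ^ 2) • ((p + q) * (2 - (p + q))) • y ^ 2
      + lam ^ 2 • (((p + q) * (2 - (p + q))) • ((2 : ℝ) • t + s) ^ 2
        + (2 * ((1 - p) ^ 2 + (1 - q) ^ 2)) • (t * (t + s)))
      + lam • (2 : ℝ) • (((2 : ℝ) • t + s) * (t * (t + s)))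
      + (t * (t + s)) ^ 2
      - (lam * c ^ 2) • (2 : ℝ) • (t * y ^ 2)
      - c ^ 2 • (t ^ 2 * y ^ 2) := by
  unfold jointPoly
  algebra

/-- The expansion of `jointPoly` for commuting elements of an arbitrary algebra, divided by
`lam ^ 3`. -/
lemma exists_jointPoly_expansion {A : Type*} [Ring A] [Algebra ℝ A] (s y t : A)
    (hsy : Commute s y) (hst : Commute s t) (hyt : Commute y t) (p q : ℝ) :
    ∃ x₁ x₂ x₃ x₄ x₅ : A, ∀ lam c : ℝ, 0 < lam →
      (lam ^ 3)⁻¹ • jointPoly s y t lam c p q =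
        (2 * ((p + q) * ((1 - p) ^ 2 + (1 - q) ^ 2))) • ((2 : ℝ) • t + s)
        - (c ^ 2 / lam) • ((p + q) * (2 - (p + q))) • y ^ 2
        + lam⁻¹ • x₁ + (lam⁻¹ ^ 2) • x₂ + (lam⁻¹ ^ 3) • x₃
        - (c ^ 2 / lam * lam⁻¹) • x₄ - (c ^ 2 / lam * lam⁻¹ ^ 2) • x₅ := by
  obtain ⟨S, hS, s, y, t, rfl, rfl, rfl⟩ := exists_commRing_algHom s y t hsy hst hyt
  let _ : CommRing S := { (inferInstance : Ring S) with mul_comm := fun a b => hS.1.comm a b }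
  refine ⟨S.val (((p + q) * (2 - (p + q))) • ((2 : ℝ) • t + s) ^ 2
        + (2 * ((1 - p) ^ 2 + (1 - q) ^ 2)) • (t * (t + s))),
    S.val ((2 : ℝ) • (((2 : ℝ) • t + s) * (t * (t + s)))), S.val ((t * (t + s)) ^ 2),
    S.val ((2 : ℝ) • (t * y ^ 2)), S.val (t ^ 2 * y ^ 2), fun lam c hlam => ?_⟩
  have h : jointPoly (s : A) (y : A) (t : A) lam c p q = S.val (jointPoly s y t lam c p q) := by
    simp [jointPoly]
  rw [h, jointPoly_expansion]
  have e1 : (lam ^ 3)⁻¹ * lam ^ 3 = 1 := by field_simp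
  have e2 : (lam ^ 3)⁻¹ * (lam ^ 2 * c ^ 2) = c ^ 2 / lam := by field_simp
  have e3 : (lam ^ 3)⁻¹ * lam ^ 2 = lam⁻¹ := by field_simp
  have e4 : (lam ^ 3)⁻¹ * lam = lam⁻¹ ^ 2 := by field_simp
  have e5 : (lam ^ 3)⁻¹ * (lam * c ^ 2) = c ^ 2 / lam * lam⁻¹ := by field_simp
  have e6 : (lam ^ 3)⁻¹ * c ^ 2 = c ^ 2 / lam * lam⁻¹ ^ 2 := by field_simp
  have h1 : ∀ x : A, (lam ^ 3)⁻¹ • lam ^ 3 • x = x := fun x => by rw [smul_smul, e1, one_smul]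
  have h3 : ∀ x : A, (lam ^ 3)⁻¹ • lam ^ 2 • x = lam⁻¹ • x := fun x => by rw [smul_smul, e3]
  rw [map_sub, map_sub, map_add, map_add, map_add, map_sub]
  simp only [map_smul S.val (lam ^ 2 * c ^ 2), map_smul S.val lam, map_smul S.val (lam * c ^ 2),
    map_smul S.val (c ^ 2), smul_sub, smul_add]
  simp only [smul_smul (lam ^ 3)⁻¹, e2, e4, e5, e6]
  simp [smul_add, h1, h3]

section Limit

variable {U : Opens (ℝ × ℝ × ℝ)} {p q : ℝ} {lam c : ℕ → ℝ}

/-- The rescaled fourth-order operators converge to the limiting operator: tested against `φ`, the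
rescaled operator is a finite sum of terms `k n * v n ψ` with `ψ` a fixed derivative of `φ` and
`k n` a convergent sequence of reals. -/
lemma tendsto_jointOp (hpq : p + q ≤ 1) (hlam : ∀ n, 0 < lam n)
    (hlam_top : Tendsto lam atTop atTop)
    (hratio : Tendsto (fun n => lam n / c n ^ 2) atTop (𝓝 1))
    (v : ℕ → 𝓓'(U, ℝ)) (u : 𝓓'(U, ℝ))
    (hv : ∀ φ : 𝓓(U, ℝ), Tendsto (fun n => v n φ) atTop (𝓝 (u φ))) (φ : 𝓓(U, ℝ)) :
    Tendsto (fun n => (lam n ^ 3)⁻¹ * jointOp U (lam n) (c n) p q (v n) φ) atTop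
      (𝓝 (4 * (p + q) * ((1 - p) ^ 2 + (1 - q) ^ 2) *
        (Dt U u + (1 / 2 : ℝ) • Ds U u - diffCoeff p q • Dy U (Dy U u)) φ)) := by
  set s := -testDeriv U (1, 0, 0) with hs_def
  set y := -testDeriv U (0, 1, 0) with hy_def
  set t := -testDeriv U (0, 0, 1) with ht_def
  obtain ⟨x₁, x₂, x₃, x₄, x₅, hx⟩ := exists_jointPoly_expansion s y t
    (testDeriv_commute _ _).neg_left.neg_right (testDeriv_commute _ _).neg_left.neg_right
    (testDeriv_commute _ _).neg_left.neg_right p q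
  have hinv : Tendsto (fun n => (lam n)⁻¹) atTop (𝓝 0) := tendsto_inv_atTop_zero.comp hlam_top
  have hγ : Tendsto (fun n => c n ^ 2 / lam n) atTop (𝓝 1) := by
    simpa using hratio.inv₀ one_ne_zero
  have hterm : ∀ {k : ℕ → ℝ} {k₀ : ℝ} (ψ : 𝓓(U, ℝ)), Tendsto k atTop (𝓝 k₀) →
      Tendsto (fun n => k n * v n ψ) atTop (𝓝 (k₀ * u ψ)) := fun ψ hk => hk.mul (hv ψ)
  have hlim := ((((((hv (((2 * ((p + q) * ((1 - p) ^ 2 + (1 - q) ^ 2))) • ((2 : ℝ) • t + s)) φ)).sub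
    (hterm ((((p + q) * (2 - (p + q))) • y ^ 2) φ) hγ)).add
    (hterm (x₁ φ) hinv)).add (hterm (x₂ φ) (hinv.pow 2))).add (hterm (x₃ φ) (hinv.pow 3))).sub
    (hterm (x₄ φ) (hγ.mul hinv))).sub (hterm (x₅ φ) (hγ.mul (hinv.pow 2)))
  convert hlim using 1
  · ext n
    rw [isTransposeOf_jointTestOp (lam n) (c n) p q (v n) φ, ← smul_eq_mul, ← map_smul,
      ← LinearMap.smul_apply, jointTestOp, hx _ _ (hlam n)]
    simp [LinearMap.add_apply, LinearMap.sub_apply]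
  · have hs : IsTransposeOf s (Ds U) := isTransposeOf_lineDeriv _
    have hy : IsTransposeOf y (Dy U) := isTransposeOf_lineDeriv _
    have ht : IsTransposeOf t (Dt U) := isTransposeOf_lineDeriv _
    have hS : (1 - p) ^ 2 + (1 - q) ^ 2 ≠ 0 := (sq_one_sub_add_sq_one_sub_pos hpq).ne'
    have e : (Dt U u + (1 / 2 : ℝ) • Ds U u - diffCoeff p q • Dy U (Dy U u)) φ
        = u (t φ) + 1 / 2 * u (s φ) - diffCoeff p q * u (y (y φ)) := by
      rw [← ht, ← hs, ← hy, ← hy]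
      simp
    rw [e, diffCoeff]
    congr 1
    simp [pow_two y, -neg_sub]
    field_simp
    ring

/-- Limits of solutions of the fourth-order equation solve the limiting equation. -/
lemma limitEq_of_tendsto (hpq : p + q ≤ 1) (hpos : 0 < p + q) (hlam : ∀ n, 0 < lam n)
    (hlam_top : Tendsto lam atTop atTop)
    (hratio : Tendsto (fun n => lam n / c n ^ 2) atTop (𝓝 1))
    (v : ℕ → 𝓓'(U, ℝ)) (u : 𝓓'(U, ℝ)) (hv₀ : ∀ n, jointOp U (lam n) (c n) p q (v n) = 0)
    (hv : ∀ φ : 𝓓(U, ℝ), Tendsto (fun n => v n φ) atTop (𝓝 (u φ))) : LimitEq U p q u := by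
  have hS : (1 - p) ^ 2 + (1 - q) ^ 2 ≠ 0 := (sq_one_sub_add_sq_one_sub_pos hpq).ne'
  have key : Dt U u + (1 / 2 : ℝ) • Ds U u - diffCoeff p q • Dy U (Dy U u) = 0 := by
    ext φ
    have h := tendsto_jointOp hpq hlam hlam_top hratio v u hv φ
    simp only [hv₀] at h
    have h0 := tendsto_nhds_unique h (b := 0) (by simp)
    rcases mul_eq_zero.1 h0 with h1 | h1
    · exact absurd h1 (mul_ne_zero (mul_ne_zero four_ne_zero hpos.ne') hS)
    · exact h1
  unfold LimitEq
  rw [sub_eq_zero] at key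
  rw [← key]
  abel

end Limit

/-! ### The path of the motion between changes of direction -/

namespace PlanarMotion

variable {Ω : Type*} [MeasurableSpace Ω] {P : Measure Ω} {lam p q : ℝ}

/-- The space-time velocity, in the variables `(s, y, t)`, of `(T(t), Y(t), t)` while the motion
has direction `j`. -/
def vel (c : ℝ) (j : ZMod 4) : ℝ × ℝ × ℝ :=
  ({j : ZMod 4 | j = 1 ∨ j = 3}.indicator (fun _ => 1) j, c * Real.sin (Real.pi / 2 * (j.val : ℝ)),
    1)

/-- The direction of the motion between the `k`-th and the `(k+1)`-st change of direction. -/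
def dir (M : PlanarMotion P lam p q) (k : ℕ) (ω : Ω) : ZMod 4 :=
  M.D₀ ω + ∑ i ∈ Finset.range k, M.turn i ω

/-- The time of the `k`-th change of direction, with `arrival 0 = 0`. -/
def arrival (M : PlanarMotion P lam p q) (k : ℕ) (ω : Ω) : ℝ :=
  ∑ i ∈ Finset.range k, M.gap i ω

/-- The value of `(T(t), Y(t), t)` at the `k`-th change of direction. -/
def pos (M : PlanarMotion P lam p q) (c : ℝ) (k : ℕ) (ω : Ω) : ℝ × ℝ × ℝ :=
  ∑ i ∈ Finset.range k, M.gap i ω • vel c (M.dir i ω)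

/-- The space-time process `(T(t), Y(t), t)`. -/
def state (M : PlanarMotion P lam p q) (c t : ℝ) (ω : Ω) : ℝ × ℝ × ℝ := (M.T t ω, M.Y c t ω, t)

/-- The almost sure event that the waiting times are positive and that there are finitely many
changes of direction in finite time. -/
def Good (M : PlanarMotion P lam p q) (ω : Ω) : Prop :=
  (∀ k, 0 < M.gap k ω) ∧ Tendsto (fun n => M.arrival n ω) atTop atTop

variable (M : PlanarMotion P lam p q) {c : ℝ} {ω : Ω}

lemma arrival_zero (ω : Ω) : M.arrival 0 ω = 0 := by simp [arrival]

lemma arrival_succ (k : ℕ) (ω : Ω) : M.arrival (k + 1) ω = M.arrival k ω + M.gap k ω := by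
  simp [arrival, Finset.sum_range_succ]

lemma pos_zero (ω : Ω) : M.pos c 0 ω = 0 := by simp [pos]

lemma pos_succ (k : ℕ) (ω : Ω) :
    M.pos c (k + 1) ω = M.pos c k ω + M.gap k ω • vel c (M.dir k ω) := by
  simp [pos, Finset.sum_range_succ]

lemma dir_succ (k : ℕ) (ω : Ω) : M.dir (k + 1) ω = M.dir k ω + M.turn k ω := by
  simp [dir, Finset.sum_range_succ, add_assoc]

lemma pos_time (k : ℕ) (ω : Ω) : (M.pos c k ω).2.2 = M.arrival k ω := by
  induction k with
  | zero => simp [pos_zero, arrival_zero]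
  | succ k ih => simp [pos_succ, arrival_succ, ih, vel]

namespace Good

variable {M}

lemma strictMono (h : M.Good ω) : StrictMono fun k => M.arrival k ω :=
  strictMono_nat_of_lt_succ fun k => by rw [arrival_succ]; linarith [h.1 k]

lemma arrival_nonneg (h : M.Good ω) (k : ℕ) : 0 ≤ M.arrival k ω := by
  have := h.strictMono.monotone (Nat.zero_le k)
  simpa [arrival_zero] using this

lemma exists_arrival (h : M.Good ω) {t : ℝ} (ht : 0 ≤ t) :
    ∃ k, M.arrival k ω ≤ t ∧ t < M.arrival (k + 1) ω := by
  have hex : ∃ n, t < M.arrival n ω := (h.2.eventually_gt_atTop t).exists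
  classical
  have hpos : Nat.find hex ≠ 0 := by
    intro h0
    have := Nat.find_spec hex
    rw [h0, arrival_zero] at this
    linarith
  obtain ⟨k, hk⟩ := Nat.exists_eq_succ_of_ne_zero hpos
  refine ⟨k, not_lt.1 (Nat.find_min hex (by omega)), ?_⟩
  have := Nat.find_spec hex
  rwa [hk] at this

lemma N_eq (h : M.Good ω) {t : ℝ} {k : ℕ} (h1 : M.arrival k ω ≤ t)
    (h2 : t < M.arrival (k + 1) ω) : M.N t ω = k := by
  have : {n : ℕ | ∑ i ∈ Finset.range (n + 1), M.gap i ω ≤ t} = Set.Iio k := by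
    ext n
    change M.arrival (n + 1) ω ≤ t ↔ n < k
    constructor
    · intro hn
      have := h.strictMono.lt_iff_lt.1 (hn.trans_lt h2)
      omega
    · intro hn
      exact (h.strictMono.monotone (show n + 1 ≤ k by omega)).trans h1
  rw [N, this, Set.ncard_eq_toFinset_card']
  simp

lemma D_eq (h : M.Good ω) {t : ℝ} {k : ℕ} (h1 : M.arrival k ω ≤ t)
    (h2 : t < M.arrival (k + 1) ω) : M.D t ω = M.dir k ω := by
  rw [D, h.N_eq h1 h2, dir]

lemma ae_eq_dir {E : Type*} (h : M.Good ω) {t : ℝ} {k : ℕ} (h1 : M.arrival k ω ≤ t)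
    (h2 : t ≤ M.arrival (k + 1) ω) (f : ZMod 4 → ℝ → E) :
    (fun τ => f (M.D τ ω) τ) =ᵐ[volume.restrict (Set.uIoc (M.arrival k ω) t)] f (M.dir k ω) := by
  rw [uIoc_of_le h1, ← restrict_Ioo_eq_restrict_Ioc]
  filter_upwards [ae_restrict_mem measurableSet_Ioo] with τ hτ
  rw [h.D_eq hτ.1.le (hτ.2.trans_le h2)]

variable {E : Type*} [NormedAddCommGroup E] [NormedSpace ℝ E]

lemma intervalIntegral_eq (h : M.Good ω) {t : ℝ} {k : ℕ} (h1 : M.arrival k ω ≤ t)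
    (h2 : t ≤ M.arrival (k + 1) ω) (f : ZMod 4 → ℝ → E) :
    ∫ τ in M.arrival k ω..t, f (M.D τ ω) τ = ∫ τ in M.arrival k ω..t, f (M.dir k ω) τ :=
  intervalIntegral.integral_congr_ae_restrict (h.ae_eq_dir h1 h2 f)

/-- The integral up to time `t` of a function of the direction, as a finite sum over the linear
pieces of the path. -/
lemma integral_D (h : M.Good ω) (f : ZMod 4 → ℝ) (k : ℕ) :
    ∀ t, M.arrival k ω ≤ t → t ≤ M.arrival (k + 1) ω →
      IntervalIntegrable (fun τ => f (M.D τ ω)) volume 0 t ∧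
      ∫ τ in (0 : ℝ)..t, f (M.D τ ω) =
        ∑ i ∈ Finset.range k, M.gap i ω * f (M.dir i ω) + (t - M.arrival k ω) * f (M.dir k ω) := by
  have hI : ∀ k t, M.arrival k ω ≤ t → t ≤ M.arrival (k + 1) ω →
      IntervalIntegrable (fun τ => f (M.D τ ω)) volume (M.arrival k ω) t := fun k t h1 h2 =>
    (intervalIntegrable_const (c := f (M.dir k ω))).congr_ae
      (h.ae_eq_dir h1 h2 (fun j _ => f j)).symm
  have hE : ∀ k t, M.arrival k ω ≤ t → t ≤ M.arrival (k + 1) ω →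
      ∫ τ in M.arrival k ω..t, f (M.D τ ω) = (t - M.arrival k ω) * f (M.dir k ω) := by
    intro k t h1 h2
    rw [h.intervalIntegral_eq h1 h2 (fun j _ => f j)]
    simp
  induction k with
  | zero =>
    intro t h1 h2
    have := hI 0 t h1 h2
    have h3 := hE 0 t h1 h2
    simp only [arrival_zero] at this h3 ⊢
    exact ⟨this, by simpa using h3⟩
  | succ k ih =>
    intro t h1 h2
    obtain ⟨i1, i2⟩ := ih (M.arrival (k + 1) ω) (h.strictMono (Nat.lt_succ_self k)).le le_rfl
    refine ⟨i1.trans (hI _ t h1 h2), ?_⟩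
    rw [← intervalIntegral.integral_add_adjacent_intervals i1 (hI _ t h1 h2), i2, hE _ t h1 h2,
      Finset.sum_range_succ, arrival_succ]
    ring

/-- Between two changes of direction, `(T(t), Y(t), t)` moves on a straight line. -/
lemma state_eq (h : M.Good ω) {t : ℝ} {k : ℕ} (h1 : M.arrival k ω ≤ t)
    (h2 : t ≤ M.arrival (k + 1) ω) :
    M.state c t ω = M.pos c k ω + (t - M.arrival k ω) • vel c (M.dir k ω) := by
  have hsum : ∀ f : ZMod 4 → ℝ × ℝ × ℝ, ∑ i ∈ Finset.range k, M.gap i ω • f (M.dir i ω) =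
      (∑ i ∈ Finset.range k, M.gap i ω * (f (M.dir i ω)).1,
        ∑ i ∈ Finset.range k, M.gap i ω * (f (M.dir i ω)).2.1,
        ∑ i ∈ Finset.range k, M.gap i ω * (f (M.dir i ω)).2.2) := fun f => by
    refine Prod.ext ?_ (Prod.ext ?_ ?_) <;> simp [Prod.fst_sum, Prod.snd_sum]
  have hT := (h.integral_D (fun j => (vel c j).1) k t h1 h2).2
  have hY := (h.integral_D (fun j => (vel c j).2.1) k t h1 h2).2
  refine Prod.ext ?_ (Prod.ext ?_ ?_)
  · rw [pos, hsum]
    exact hT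
  · rw [pos, hsum]
    exact hY
  · have := M.pos_time (c := c) k ω
    simp [state, this, vel]

end Good

end PlanarMotion

/-! ### Integrals along the path -/

/-- The set of the `(s, y, t')` with `0 ≤ t' ≤ t`. -/
def strip (t : ℝ) : Set (ℝ × ℝ × ℝ) := {x | 0 ≤ x.2.2 ∧ x.2.2 ≤ t}

lemma measurableSet_strip (t : ℝ) : MeasurableSet (strip t) :=
  (measurableSet_le measurable_const measurable_snd.snd).inter
    (measurableSet_le measurable_snd.snd measurable_const)

namespace PlanarMotion

variable {Ω : Type*} [MeasurableSpace Ω] {P : Measure Ω} {lam p q : ℝ}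
  {M : PlanarMotion P lam p q} {c : ℝ} {ω : Ω}
  {E : Type*} [NormedAddCommGroup E] [NormedSpace ℝ E]

/-- The integral of `ψ (D(τ), (T(τ), Y(τ), τ))` between the `k`-th and the `(k+1)`-st change of
direction. -/
def occ (M : PlanarMotion P lam p q) (c : ℝ) (ψ : ZMod 4 → ℝ × ℝ × ℝ → E) (k : ℕ) (ω : Ω) : E :=
  ∫ σ in (0 : ℝ)..M.gap k ω, ψ (M.dir k ω) (M.pos c k ω + σ • vel c (M.dir k ω))

namespace Good

lemma pos_mem_strip_iff (h : M.Good ω) (k : ℕ) (t : ℝ) :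
    M.pos c k ω ∈ strip t ↔ M.arrival k ω ≤ t := by
  simp [strip, pos_time, h.arrival_nonneg k]

lemma pos_add_mem_strip_iff (h : M.Good ω) (k : ℕ) (t : ℝ) {σ : ℝ} (hσ : 0 ≤ σ) (j : ZMod 4) :
    M.pos c k ω + σ • vel c j ∈ strip t ↔ σ ≤ t - M.arrival k ω := by
  have := h.arrival_nonneg k
  simp only [strip, vel, Set.mem_ofPred_eq, Prod.snd_add, pos_time, Prod.smul_snd, smul_eq_mul,
    mul_one]
  constructor
  · rintro ⟨-, h2⟩; linarith
  · intro h2; exact ⟨by linarith, by linarith⟩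

/-- At time `t` exactly one of the linear pieces of the path is current. -/
lemma sum_indicator_arrival (h : M.Good ω) {t : ℝ} (ht : 0 ≤ t)
    {E : Type*} [AddCommMonoid E] (f : ZMod 4 → E) (K : ℕ) :
    ∑ k ∈ Finset.range K, {k | M.arrival k ω ≤ t ∧ t < M.arrival (k + 1) ω}.indicator
      (fun k => f (M.dir k ω)) k = {K | t < M.arrival K ω}.indicator (fun _ => f (M.D t ω)) K := by
  classical
  obtain ⟨k₀, h1, h2⟩ := h.exists_arrival ht
  have huniq : ∀ k, M.arrival k ω ≤ t ∧ t < M.arrival (k + 1) ω ↔ k = k₀ := by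
    refine fun k => ⟨fun hk => ?_, fun hk => hk ▸ ⟨h1, h2⟩⟩
    rw [← h.N_eq hk.1 hk.2, h.N_eq h1 h2]
  have hK : t < M.arrival K ω ↔ k₀ < K := by
    refine ⟨fun hK => h.strictMono.lt_iff_lt.1 (h1.trans_lt hK), fun hK => h2.trans_le ?_⟩
    exact h.strictMono.monotone (show k₀ + 1 ≤ K from hK)
  simp [Set.indicator_apply, huniq, hK, h.D_eq h1 h2, Finset.sum_ite_eq']

/-- The fundamental theorem of calculus along one linear piece of the path. -/
lemma occ_indicator_deriv [CompleteSpace E] (h : M.Good ω) {t : ℝ} {F F' : ZMod 4 → ℝ × ℝ × ℝ → E}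
    (hF' : ∀ j, Continuous (F' j))
    (hF : ∀ j x, HasLineDerivAt ℝ (F j) (F' j x) x (vel c j)) (k : ℕ) :
    M.occ c (fun j => (strip t).indicator (F' j)) k ω =
      {k | M.arrival k ω ≤ t ∧ t < M.arrival (k + 1) ω}.indicator
          (fun k => F (M.dir k ω) (M.state c t ω)) k
        + (strip t).indicator (F (M.dir k ω)) (M.pos c (k + 1) ω)
        - (strip t).indicator (F (M.dir k ω)) (M.pos c k ω) := by
  classical
  set j := M.dir k ω with hj
  have hg := h.1 k
  have hderiv : ∀ σ : ℝ, HasDerivAt (fun σ => F j (M.pos c k ω + σ • vel c j))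
      (F' j (M.pos c k ω + σ • vel c j)) σ := by
    intro σ
    have h1 := hF j (M.pos c k ω + σ • vel c j)
    unfold HasLineDerivAt at h1
    have h3 : HasDerivAt (fun τ : ℝ => τ - σ) 1 σ := (hasDerivAt_id σ).sub_const σ
    have h4 := HasDerivAt.scomp σ (g₁ := fun τ : ℝ => F j (M.pos c k ω + σ • vel c j + τ • vel c j))
      (h := fun τ : ℝ => τ - σ) (by simpa using h1) h3
    rw [one_smul] at h4
    refine h4.congr_of_eventuallyEq (Eventually.of_forall fun τ => ?_)
    simp only [Function.comp_apply, sub_smul]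
    congr 1
    abel
  have hcont : Continuous fun σ : ℝ => F' j (M.pos c k ω + σ • vel c j) :=
    (hF' j).comp (by fun_prop)
  have ftc : ∀ m : ℝ, ∫ σ in (0 : ℝ)..m, F' j (M.pos c k ω + σ • vel c j) =
      F j (M.pos c k ω + m • vel c j) - F j (M.pos c k ω) := fun m => by
    rw [intervalIntegral.integral_eq_sub_of_hasDerivAt (fun σ _ => hderiv σ)
      (hcont.intervalIntegrable _ _)]
    simp
  have hmem : ∀ {σ : ℝ}, 0 ≤ σ → (M.pos c k ω + σ • vel c j ∈ strip t ↔ σ ≤ t - M.arrival k ω) :=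
    fun hσ => h.pos_add_mem_strip_iff k t hσ j
  have hsucc := M.arrival_succ k ω
  simp only [occ, ← hj]
  rcases lt_or_ge t (M.arrival k ω) with h1 | h1
  · rw [Set.indicator_of_notMem (by simp [h1]), Set.indicator_of_notMem, Set.indicator_of_notMem,
      intervalIntegral.integral_congr_Ioo_of_le (g := fun _ => 0) hg.le]
    · simp
    · intro σ hσ
      exact Set.indicator_of_notMem (fun hm => by
        have := (hmem hσ.1.le).1 hm; linarith [hσ.1]) _
    · rw [h.pos_mem_strip_iff]; linarith
    · rw [h.pos_mem_strip_iff]; linarith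
  · rw [Set.indicator_of_mem (s := strip t) (a := M.pos c k ω) ((h.pos_mem_strip_iff k t).2 h1)]
    rcases lt_or_ge t (M.arrival (k + 1) ω) with h2 | h2
    -- the piece is current at time `t`, and the strip cuts it there
    · rw [Set.indicator_of_mem (by exact ⟨h1, h2⟩),
        Set.indicator_of_notMem (by rw [h.pos_mem_strip_iff]; linarith), h.state_eq h1 h2.le,
        add_zero, ← hj, ← ftc]
      have hsub : Set.Ioc 0 (t - M.arrival k ω) ⊆ Set.Ioc 0 (M.gap k ω) :=
        Set.Ioc_subset_Ioc_right (by linarith)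
      rw [intervalIntegral.integral_of_le hg.le, intervalIntegral.integral_of_le (by linarith),
        setIntegral_eq_of_subset_of_forall_sdiff_eq_zero measurableSet_Ioc hsub]
      · refine setIntegral_congr_fun measurableSet_Ioc fun σ hσ => ?_
        exact Set.indicator_of_mem ((hmem hσ.1.le).2 hσ.2) _
      · rintro σ ⟨hσ, hσ'⟩
        refine Set.indicator_of_notMem (fun hm => hσ' ⟨hσ.1, (hmem hσ.1.le).1 hm⟩) _
    · rw [Set.indicator_of_notMem (by simp [h2]),
        Set.indicator_of_mem ((h.pos_mem_strip_iff (k + 1) t).2 h2), zero_add, pos_succ, ← hj,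
        ← ftc]
      rw [intervalIntegral.integral_of_le hg.le, intervalIntegral.integral_of_le hg.le]
      refine setIntegral_congr_fun measurableSet_Ioc fun σ hσ => ?_
      exact Set.indicator_of_mem ((hmem hσ.1.le).2 (by linarith [hσ.2])) _

variable [MeasurableSpace E] [BorelSpace E] [SecondCountableTopology E]

/-- The occupation integrals of the first `K` pieces add up to an integral along the path, up
to time `t`. -/
lemma sum_occ_indicator (h : M.Good ω) {t C : ℝ} (ht : 0 ≤ t) {G : ZMod 4 → ℝ × ℝ × ℝ → E}
    (hG : ∀ j, Measurable (G j)) (hC : ∀ j, ∀ x ∈ strip t, ‖G j x‖ ≤ C) (K : ℕ) :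
    ∑ k ∈ Finset.range K, M.occ c (fun j => (strip t).indicator (G j)) k ω =
      ∫ τ in (0 : ℝ)..(min (M.arrival K ω) t), G (M.D τ ω) (M.state c τ ω) := by
  set ψ : ZMod 4 → ℝ × ℝ × ℝ → E := fun j => (strip t).indicator (G j) with hψ
  have hψm : ∀ j, Measurable (ψ j) := fun j => (hG j).indicator (measurableSet_strip t)
  have hψC : ∀ j x, ‖ψ j x‖ ≤ max C 0 := by
    intro j x
    by_cases hx : x ∈ strip t
    · simpa [hψ, hx] using Or.inl (hC j x hx)
    · simp [hψ, hx]
  have hle : ∀ k, M.arrival k ω ≤ M.arrival (k + 1) ω := fun k =>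
    (h.strictMono (Nat.lt_succ_self k)).le
  have hae : ∀ k, (fun τ => ψ (M.D τ ω) (M.state c τ ω))
      =ᵐ[volume.restrict (Set.uIoc (M.arrival k ω) (M.arrival (k + 1) ω))] fun τ =>
        ψ (M.dir k ω) (M.pos c k ω + (τ - M.arrival k ω) • vel c (M.dir k ω)) := by
    intro k
    refine (h.ae_eq_dir (hle k) le_rfl fun j τ => ψ j (M.state c τ ω)).trans ?_
    rw [Set.uIoc_of_le (hle k)]
    filter_upwards [ae_restrict_mem measurableSet_Ioc] with τ hτ
    rw [h.state_eq hτ.1.le hτ.2]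
  have hint : ∀ k, IntervalIntegrable (fun τ => ψ (M.D τ ω) (M.state c τ ω)) volume
      (M.arrival k ω) (M.arrival (k + 1) ω) := by
    intro k
    refine IntervalIntegrable.congr_ae ?_ (hae k).symm
    rw [intervalIntegrable_iff]
    refine Measure.integrableOn_of_bounded (M := max C 0) (by simp) ?_ ?_
    · exact ((hψm _).comp (by fun_prop)).aestronglyMeasurable
    · exact Eventually.of_forall fun τ => hψC _ _
  have hocc : ∀ k, M.occ c ψ k ω = ∫ τ in M.arrival k ω..M.arrival (k + 1) ω,
      ψ (M.D τ ω) (M.state c τ ω) := by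
    intro k
    rw [intervalIntegral.integral_congr_ae_restrict (hae k), occ,
      intervalIntegral.integral_comp_sub_right (fun σ =>
        ψ (M.dir k ω) (M.pos c k ω + σ • vel c (M.dir k ω))), arrival_succ]
    simp
  simp only [hocc]
  rw [intervalIntegral.sum_integral_adjacent_intervals fun k _ => hint k, arrival_zero]
  have hK := h.arrival_nonneg K
  rw [intervalIntegral.integral_of_le hK, intervalIntegral.integral_of_le (le_min hK ht),
    setIntegral_eq_of_subset_of_forall_sdiff_eq_zero measurableSet_Ioc
      (Set.Ioc_subset_Ioc_right (min_le_left _ _))]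
  · refine setIntegral_congr_fun measurableSet_Ioc fun τ hτ => ?_
    exact Set.indicator_of_mem (show M.state c τ ω ∈ strip t from
      ⟨hτ.1.le, hτ.2.trans (min_le_right _ _)⟩) _
  · rintro τ ⟨hτ, hτ'⟩
    refine Set.indicator_of_notMem (fun hm => hτ' ⟨hτ.1, le_min hτ.2 hm.2⟩) _

end Good

end PlanarMotion

/-! ### Independence and exponential waiting times -/

section Independence

variable {Ω α β γ : Type*} [MeasurableSpace Ω] [MeasurableSpace α] [MeasurableSpace β]
  [MeasurableSpace γ] {P : Measure Ω}

/-- If `X` is independent of `(Y, Z)` and `Y` is independent of `Z`, then `(X, Y)` is independent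
of `Z`. -/
lemma indepFun_prodMk_left_of_prodMk_right [IsProbabilityMeasure P] {X : Ω → α} {Y : Ω → β}
    {Z : Ω → γ} (hX : Measurable X)
    (hY : Measurable Y) (hZ : Measurable Z) (h : IndepFun X (fun ω => (Y ω, Z ω)) P)
    (h' : IndepFun Y Z P) : IndepFun (fun ω => (X ω, Y ω)) Z P := by
  have hXY : IndepFun X Y P := h.comp (φ := id) (ψ := Prod.fst) measurable_id measurable_fst
  have := Measure.isProbabilityMeasure_map (μ := P) hX.aemeasurable
  have := Measure.isProbabilityMeasure_map (μ := P) hY.aemeasurable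
  have := Measure.isProbabilityMeasure_map (μ := P) hZ.aemeasurable
  rw [indepFun_iff_map_prod_eq_prod_map_map (by fun_prop) (by fun_prop)] at h h' hXY ⊢
  apply (MeasurableEquiv.prodAssoc (α := α) (β := β) (γ := γ)).map_measurableEquiv_injective
  rw [hXY, Measure.prodAssoc_prod, ← h', ← h,
    Measure.map_map MeasurableEquiv.prodAssoc.measurable (by fun_prop)]
  rfl

/-- A term of an independent sequence is independent of the sequence of the following terms. -/
lemma iIndepFun_indepFun_future {X : ℕ → Ω → α} (hX : ∀ k, Measurable (X k)) (h : iIndepFun X P)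
    (k : ℕ) : IndepFun (X k) (fun ω i => X (k + 1 + i) ω) P := by
  have h1 := indep_iSup_of_disjoint (fun i => (hX i).comap_le) h.iIndep
    (S := {k}) (T := Set.Ioi k) (by simp)
  rw [IndepFun_iff_Indep]
  refine indep_of_indep_of_le_left (indep_of_indep_of_le_right h1 ?_) ?_
  · rw [MeasurableSpace.pi, MeasurableSpace.comap_iSup]
    refine iSup_le fun i => ?_
    rw [MeasurableSpace.comap_comp]
    exact le_iSup₂_of_le (k + 1 + i) (by simp; omega) le_rfl
  · exact le_iSup₂_of_le k (by simp) le_rfl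

end Independence

section Exponential

variable {E : Type*} [NormedAddCommGroup E] [NormedSpace ℝ E] {r : ℝ}

lemma measurable_exponentialPDF (r : ℝ) : Measurable (exponentialPDF r) :=
  (measurable_exponentialPDFReal r).ennreal_ofReal

lemma integral_expMeasure (hr : 0 < r) (f : ℝ → E) :
    ∫ x, f x ∂(expMeasure r) = ∫ x in Ioi (0 : ℝ), (r * Real.exp (-(r * x))) • f x := by
  have h : expMeasure r = volume.withDensity (exponentialPDF r) := rfl
  rw [h, integral_withDensity_eq_integral_toReal_smul
    (measurable_exponentialPDF r) (by simp [exponentialPDF]),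
    ← integral_Ici_eq_integral_Ioi, ← integral_indicator measurableSet_Ici]
  congr 1
  ext x
  rw [exponentialPDF_eq]
  by_cases hx : 0 ≤ x
  · rw [if_pos hx, Set.indicator_of_mem (by exact hx), ENNReal.toReal_ofReal (by positivity)]
  · rw [if_neg hx, Set.indicator_of_notMem (by exact hx)]
    simp

lemma expMeasure_Iic_zero (hr : 0 < r) : expMeasure r (Iic 0) = 0 := by
  have := isProbabilityMeasure_expMeasure hr
  have h := cdf_expMeasure_eq hr 0
  rw [cdf_eq_real] at h
  simpa [measureReal_eq_zero_iff] using h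

lemma integrable_id_expMeasure (hr : 0 < r) : Integrable (fun x : ℝ => x) (expMeasure r) := by
  have h : expMeasure r = volume.withDensity (exponentialPDF r) := rfl
  rw [h, integrable_withDensity_iff_integrable_smul₀'
    (measurable_exponentialPDF r).aemeasurable (by simp [exponentialPDF])]
  have hdom : Integrable ((Ici (0 : ℝ)).indicator fun x => 2 * Real.exp (-(r / 2) * x)) := by
    rw [integrable_indicator_iff measurableSet_Ici, integrableOn_Ici_iff_integrableOn_Ioi]
    exact (exp_neg_integrableOn_Ioi 0 (by positivity)).const_mul 2
  refine hdom.mono' ?_ (Eventually.of_forall fun x => ?_)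
  · exact ((measurable_exponentialPDF r).ennreal_toReal.smul
      measurable_id).aestronglyMeasurable
  · rw [exponentialPDF_eq]
    by_cases hx : 0 ≤ x
    · rw [if_pos hx, Set.indicator_of_mem (by exact hx), ENNReal.toReal_ofReal (by positivity),
        smul_eq_mul, Real.norm_of_nonneg (by positivity)]
      have h1 : r / 2 * x ≤ Real.exp (r / 2 * x) := by linarith [Real.add_one_le_exp (r / 2 * x)]
      have h2 : Real.exp (-(r * x)) = Real.exp (-(r / 2) * x) * Real.exp (-(r / 2) * x) := by
        rw [← Real.exp_add]; congr 1; ring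
      have h3 : Real.exp (-(r / 2) * x) * Real.exp (r / 2 * x) = 1 := by
        rw [← Real.exp_add]; simp
      have h4 : 0 < Real.exp (-(r / 2) * x) := Real.exp_pos _
      rw [h2]
      nlinarith [mul_le_mul_of_nonneg_left h1 h4.le]
    · rw [if_neg hx, Set.indicator_of_notMem (by exact hx)]
      simp

lemma integral_Ioi_exp_neg_mul (hr : 0 < r) (σ : ℝ) :
    ∫ x in Ioi σ, r * Real.exp (-(r * x)) = Real.exp (-(r * σ)) := by
  rw [integral_const_mul]
  have := integral_exp_mul_Ioi (a := -r) (by linarith) σ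
  simp only [neg_mul] at this
  rw [this]
  field_simp

/-- For an exponential time `g` of rate `r`, `𝔼 ∫₀^g χ = r⁻¹ 𝔼 χ(g)`: both are equal to
`∫₀^∞ e^{-r σ} χ(σ) dσ`, by Fubini. -/
lemma integral_expMeasure_integral (hr : 0 < r) [CompleteSpace E] [MeasurableSpace E]
    [BorelSpace E] [SecondCountableTopology E] {χ : ℝ → E} (hχ : Measurable χ) {C : ℝ}
    (hC : ∀ x, ‖χ x‖ ≤ C) :
    ∫ g, (∫ σ in Ioc 0 g, χ σ) ∂(expMeasure r) = r⁻¹ • ∫ x, χ x ∂(expMeasure r) := by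
  have hC0 : 0 ≤ C := (norm_nonneg _).trans (hC 0)
  rw [integral_expMeasure hr, integral_expMeasure hr, ← integral_smul]
  set f : ℝ → ℝ → E := fun g σ => (Iic g).indicator
    (fun σ => (r * Real.exp (-(r * g))) • χ σ) σ with hf
  have h1 : ∀ g : ℝ, (r * Real.exp (-(r * g))) • ∫ σ in Ioc 0 g, χ σ = ∫ σ in Ioi 0, f g σ := by
    intro g
    rw [hf, setIntegral_indicator measurableSet_Iic, Ioi_inter_Iic, integral_smul]
  have hsec : ∀ σ g : ℝ, f g σ =
      (Ici σ).indicator (fun g => (r * Real.exp (-(r * g))) • χ σ) g := by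
    intro σ g
    simp only [hf, Set.indicator_apply, Set.mem_Iic, Set.mem_Ici]
  have hexp : ∀ σ : ℝ, IntegrableOn (fun g => r * Real.exp (-(r * g))) (Ioi σ) := fun σ => by
    have := (exp_neg_integrableOn_Ioi σ hr).const_mul r
    simp only [neg_mul] at this
    exact this
  have h2 : ∀ σ ∈ Ioi (0 : ℝ), ∫ g in Ioi 0, f g σ = r⁻¹ • (r * Real.exp (-(r * σ))) • χ σ := by
    intro σ hσ
    have hsub : Ioi (0 : ℝ) ∩ Ici σ = Ici σ :=
      Set.inter_eq_right.2 fun x hx => lt_of_lt_of_le (show (0 : ℝ) < σ from hσ) hx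
    simp only [hsec]
    rw [setIntegral_indicator measurableSet_Ici, hsub, integral_Ici_eq_integral_Ioi,
      integral_smul_const, integral_Ioi_exp_neg_mul hr, smul_smul]
    congr 1
    field_simp
  simp only [h1]
  rw [integral_integral_swap, setIntegral_congr_fun measurableSet_Ioi h2]
  have hmeas : Measurable (Function.uncurry f) := by
    have : Function.uncurry f = {z : ℝ × ℝ | z.2 ≤ z.1}.indicator
        fun z => (r * Real.exp (-(r * z.1))) • χ z.2 := by
      ext z; simp [hf, Function.uncurry, Set.indicator_apply]
    rw [this]
    exact Measurable.indicator (by fun_prop) (measurableSet_le measurable_snd measurable_fst)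
  rw [integrable_prod_iff' hmeas.aestronglyMeasurable]
  constructor
  · refine Eventually.of_forall fun σ => ?_
    simp only [Function.uncurry_apply_pair, hsec]
    refine Integrable.indicator ?_ measurableSet_Ici
    exact (hexp 0).smul_const _
  · have hdom : IntegrableOn (fun σ => C * Real.exp (-r * σ)) (Ioi 0) :=
      (exp_neg_integrableOn_Ioi 0 hr).const_mul C
    refine hdom.mono' ?_ ?_
    · exact hmeas.norm.stronglyMeasurable.integral_prod_left'.aestronglyMeasurable
    · filter_upwards [ae_restrict_mem measurableSet_Ioi] with σ hσ
      have hsub : Ioi (0 : ℝ) ∩ Ici σ = Ici σ :=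
        Set.inter_eq_right.2 fun x hx => lt_of_lt_of_le (show (0 : ℝ) < σ from hσ) hx
      simp only [Function.uncurry_apply_pair, hsec, norm_indicator_eq_indicator_norm, norm_smul]
      rw [setIntegral_indicator measurableSet_Ici, hsub, integral_Ici_eq_integral_Ioi,
        integral_mul_const]
      have : ∀ g : ℝ, ‖r * Real.exp (-(r * g))‖ = r * Real.exp (-(r * g)) := fun g =>
        Real.norm_of_nonneg (by positivity)
      simp only [this]
      rw [integral_Ioi_exp_neg_mul hr, Real.norm_of_nonneg (by positivity), mul_comm, neg_mul]
      gcongr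
      exact hC σ

lemma measurable_integral_Ioc {α : Type*} [MeasurableSpace α] [MeasurableSpace E]
    [BorelSpace E] [SecondCountableTopology E] {f : α × ℝ → E} (hf : Measurable f) :
    Measurable fun z : α × ℝ => ∫ σ in Ioc 0 z.2, f (z.1, σ) := by
  have : (fun z : α × ℝ => ∫ σ in Ioc 0 z.2, f (z.1, σ)) = fun z => ∫ σ,
      {w : (α × ℝ) × ℝ | 0 < w.2 ∧ w.2 ≤ w.1.2}.indicator (fun w => f (w.1.1, w.2)) (z, σ) := by
    ext z
    rw [← integral_indicator measurableSet_Ioc]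
    simp [Set.indicator_apply]
  rw [this]
  have hs : MeasurableSet {w : (α × ℝ) × ℝ | 0 < w.2 ∧ w.2 ≤ w.1.2} :=
    (measurableSet_lt measurable_const measurable_snd).inter
      (measurableSet_le measurable_snd measurable_fst.snd)
  have hm : Measurable ({w : (α × ℝ) × ℝ | 0 < w.2 ∧ w.2 ≤ w.1.2}.indicator
      fun w => f (w.1.1, w.2)) := (hf.comp (by fun_prop)).indicator hs
  exact hm.stronglyMeasurable.integral_prod_right'.measurable

end Exponential

/-! ### The embedded chain -/

namespace PlanarMotion

variable {Ω : Type*} [MeasurableSpace Ω] {P : Measure Ω} {lam p q : ℝ} {c : ℝ}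

section Laws

variable (M : PlanarMotion P lam p q)

lemma measurable_add_zmod : Measurable fun z : ZMod 4 × ZMod 4 => z.1 + z.2 :=
  measurable_of_countable _

lemma measurable_dir (k : ℕ) : Measurable (M.dir k) :=
  M.measurable_D₀.add (Finset.measurable_fun_sum _ fun i _ => M.measurable_turn i)

lemma measurable_vel (c : ℝ) : Measurable (vel c) := measurable_of_countable _

lemma measurable_pos (c : ℝ) (k : ℕ) : Measurable (M.pos c k) :=
  Finset.measurable_fun_sum _ fun i _ =>
    (M.measurable_gap i).smul ((measurable_vel c).comp (M.measurable_dir i))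

lemma measurable_arrival (k : ℕ) : Measurable (M.arrival k) :=
  Finset.measurable_fun_sum _ fun i _ => M.measurable_gap i

lemma ae_gap_pos (hlam : 0 < lam) (k : ℕ) : ∀ᵐ ω ∂P, 0 < M.gap k ω := by
  have h : P.map (M.gap k) (Iic 0) = 0 := by rw [M.law_gap, expMeasure_Iic_zero hlam]
  rw [Measure.map_apply (M.measurable_gap k) measurableSet_Iic] at h
  rw [ae_iff]
  convert h using 2
  ext ω
  simp

variable [IsProbabilityMeasure P]

/-- Almost surely there are finitely many changes of direction in finite time: by the law of large
numbers, already the sums of the `min (gap k) 1` tend to infinity. -/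
lemma ae_good (hlam : 0 < lam) : ∀ᵐ ω ∂P, M.Good ω := by
  -- the truncation makes integrability immediate
  set X : ℕ → Ω → ℝ := fun k ω => min (M.gap k ω) 1 with hX
  have hXm : ∀ k, Measurable (X k) := fun k => (M.measurable_gap k).min measurable_const
  have hpos : ∀ᵐ ω ∂P, ∀ k, 0 < M.gap k ω := ae_all_iff.2 fun k => M.ae_gap_pos hlam k
  have hint : Integrable (X 0) P := by
    refine Integrable.of_bound (hXm 0).aestronglyMeasurable 1 ?_
    filter_upwards [hpos] with ω hω
    rw [Real.norm_of_nonneg (le_min (hω 0).le zero_le_one)]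
    exact min_le_right _ _
  have hindep : Pairwise fun i j => IndepFun (X i) (X j) P := fun i j hij =>
    (M.indep_steps.indepFun hij).comp (φ := fun z : ℝ × ZMod 4 => min z.1 1)
      (ψ := fun z : ℝ × ZMod 4 => min z.1 1)
      (measurable_fst.min measurable_const) (measurable_fst.min measurable_const)
  have hident : ∀ i, IdentDistrib (X i) (X 0) P P := fun i => by
    have : IdentDistrib (M.gap i) (M.gap 0) P P :=
      ⟨(M.measurable_gap i).aemeasurable, (M.measurable_gap 0).aemeasurable, by
        rw [M.law_gap, M.law_gap]⟩
    exact this.comp (u := fun x => min x 1) (measurable_id.min measurable_const)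
  have hmean : 0 < ∫ ω, X 0 ω ∂P := by
    rw [integral_pos_iff_support_of_nonneg_ae _ hint]
    · have : Function.support (X 0) =ᵐ[P] Set.univ := by
        filter_upwards [hpos] with ω hω
        exact propext ⟨fun _ => trivial, fun _ => (lt_min (hω 0) one_pos).ne'⟩
      rw [measure_congr this, measure_univ]
      exact one_pos
    · filter_upwards [hpos] with ω hω
      exact le_min (hω 0).le zero_le_one
  filter_upwards [hpos, strong_law_ae_real X hint hindep hident] with ω hω hlln
  refine ⟨hω, ?_⟩
  have h1 := Tendsto.atTop_mul_pos hmean tendsto_natCast_atTop_atTop hlln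
  refine tendsto_atTop_mono (fun n => ?_) h1
  have h2 : (n : ℝ) * ((∑ i ∈ Finset.range n, X i ω) / n) = ∑ i ∈ Finset.range n, X i ω := by
    rcases eq_or_ne n 0 with rfl | hn
    · simp
    · field_simp
  rw [h2]
  exact Finset.sum_le_sum fun i _ => min_le_left _ _

/-- The position of the chain after `k` steps is independent of the following steps. -/
lemma indepFun_future (c : ℝ) (k : ℕ) :
    IndepFun (fun ω => (M.dir k ω, M.pos c k ω)) (fun ω i => (M.gap (k + i) ω, M.turn (k + i) ω))
      P := by
  have hstep : ∀ k, Measurable fun ω => (M.gap k ω, M.turn k ω) := fun k =>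
    (M.measurable_gap k).prodMk (M.measurable_turn k)
  induction k with
  | zero =>
    have hφ : Measurable fun d : ZMod 4 => (d, (0 : ℝ × ℝ × ℝ)) := measurable_of_countable _
    refine (M.indep_D₀.comp (φ := fun d => (d, (0 : ℝ × ℝ × ℝ))) (ψ := id) hφ
      measurable_id).congr ?_ ?_
    · exact Eventually.of_forall fun ω => by simp [dir, pos]
    · exact Eventually.of_forall fun ω => by simp
  | succ k ih =>
    have h1 := ih.comp (φ := id) (ψ := fun f : ℕ → ℝ × ZMod 4 => (f 0, fun i => f (i + 1)))
      measurable_id (by fun_prop)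
    have h2 := iIndepFun_indepFun_future hstep M.indep_steps k
    have h3 := indepFun_prodMk_left_of_prodMk_right (P := P)
      ((M.measurable_dir k).prodMk (M.measurable_pos c k)) (hstep k)
      (measurable_pi_lambda _ fun i => hstep (k + 1 + i))
      (h1.congr (Eventually.of_forall fun ω => rfl) (Eventually.of_forall fun ω => by
        simp [add_assoc, add_comm 1])) h2
    refine h3.comp (φ := fun z : (ZMod 4 × ℝ × ℝ × ℝ) × ℝ × ZMod 4 =>
      (z.1.1 + z.2.2, z.1.2 + z.2.1 • vel c z.1.1)) (ψ := id) ?_ measurable_id |>.congr ?_ ?_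
    · exact (measurable_add_zmod.comp (measurable_fst.fst.prodMk measurable_snd.snd)).prodMk
        (measurable_fst.snd.add (measurable_snd.fst.smul
          ((measurable_vel c).comp measurable_fst.fst)))
    · exact Eventually.of_forall fun ω => by simp [dir_succ, pos_succ]
    · exact Eventually.of_forall fun ω => rfl

/-- The waiting time and the turn of one step are independent of the position of the chain before
it. -/
lemma indepFun_step (c : ℝ) (k : ℕ) :
    IndepFun (fun ω => (M.dir k ω, M.pos c k ω)) (fun ω => (M.gap k ω, M.turn k ω)) P :=
  (M.indepFun_future c k).comp (φ := id) (ψ := fun f : ℕ → ℝ × ZMod 4 => f 0) measurable_id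
    (measurable_pi_apply 0)

lemma map_dir_pos_gap (c : ℝ) (k : ℕ) :
    P.map (fun ω => ((M.dir k ω, M.pos c k ω), M.gap k ω)) =
      (P.map fun ω => (M.dir k ω, M.pos c k ω)).prod (expMeasure lam) := by
  have h : IndepFun (fun ω => (M.dir k ω, M.pos c k ω)) (M.gap k) P :=
    (M.indepFun_step c k).comp (φ := id) (ψ := Prod.fst) measurable_id measurable_fst
  rw [← M.law_gap k, (indepFun_iff_map_prod_eq_prod_map_map
    ((M.measurable_dir k).prodMk (M.measurable_pos c k)).aemeasurable
    (M.measurable_gap k).aemeasurable).1 h]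

lemma map_dir_pos_succ_turn (c : ℝ) (k : ℕ) :
    P.map (fun ω => ((M.dir k ω, M.pos c (k + 1) ω), M.turn k ω)) =
      (P.map fun ω => (M.dir k ω, M.pos c (k + 1) ω)).prod (P.map (M.turn k)) := by
  have h1 := indepFun_prodMk_left_of_prodMk_right
    ((M.measurable_dir k).prodMk (M.measurable_pos c k)) (M.measurable_gap k) (M.measurable_turn k)
    (M.indepFun_step c k) (M.indep_gap_turn k)
  have h2 : IndepFun (fun ω => (M.dir k ω, M.pos c (k + 1) ω)) (M.turn k) P := by
    refine h1.comp (φ := fun z : (ZMod 4 × ℝ × ℝ × ℝ) × ℝ =>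
      (z.1.1, z.1.2 + z.2 • vel c z.1.1)) (ψ := id) ?_ measurable_id |>.congr ?_ ?_
    · exact measurable_fst.fst.prodMk (measurable_fst.snd.add (measurable_snd.smul
        ((measurable_vel c).comp measurable_fst.fst)))
    · exact Eventually.of_forall fun ω => by simp [pos_succ]
    · exact Eventually.of_forall fun ω => rfl
  exact (indepFun_iff_map_prod_eq_prod_map_map
    ((M.measurable_dir k).prodMk (M.measurable_pos c (k + 1))).aemeasurable
    (M.measurable_turn k).aemeasurable).1 h2

/-- The three probabilities of the possible turns exhaust the total mass. -/
lemma law_turn_zero (k : ℕ) : P.real {ω | M.turn k ω = 0} = 0 := by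
  have := Measure.isProbabilityMeasure_map (μ := P) (M.measurable_turn k).aemeasurable
  have h : ∀ j, P.real {ω | M.turn k ω = j} = (P.map (M.turn k)).real {j} := fun j => by
    rw [map_measureReal_apply (M.measurable_turn k) (measurableSet_singleton j)]
    rfl
  have hsum : ∑ j : ZMod 4, (P.map (M.turn k)).real {j} = 1 := by
    rw [sum_measureReal_singleton]
    simp
  have h4 : ∑ j : ZMod 4, (P.map (M.turn k)).real {j} = (P.map (M.turn k)).real {0} +
      (P.map (M.turn k)).real {1} + (P.map (M.turn k)).real {2} + (P.map (M.turn k)).real {-1} :=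
    Fin.sum_univ_four _
  rw [h4, ← h, ← h, ← h, ← h, M.law_turn_ccw, M.law_turn_cw, M.law_turn_reflect] at hsum
  linarith

end Laws

section OneStep

variable (M : PlanarMotion P lam p q)
  {E : Type*} [NormedAddCommGroup E] [NormedSpace ℝ E]

/-- A change of direction, on functions of the direction and of the point of space-time. -/
def turnOp (p q : ℝ) (F : ZMod 4 → ℝ × ℝ × ℝ → E) (j : ZMod 4) (x : ℝ × ℝ × ℝ) : E :=
  p • F (j + 1) x + q • F (j - 1) x + (1 - p - q) • F (j + 2) x

variable {Φ : ZMod 4 → ℝ × ℝ × ℝ → E} {C : ℝ}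

lemma occ_ae_eq (hlam : 0 < lam) (k : ℕ) : M.occ c Φ k =ᵐ[P] fun ω =>
    ∫ σ in Ioc 0 (M.gap k ω), Φ (M.dir k ω) (M.pos c k ω + σ • vel c (M.dir k ω)) := by
  filter_upwards [M.ae_gap_pos hlam k] with ω hω
  rw [occ, intervalIntegral.integral_of_le hω.le]

variable [MeasurableSpace E] [BorelSpace E] [SecondCountableTopology E]

lemma measurable_integral_piece (c : ℝ) (hΦ : ∀ j, Measurable (Φ j)) :
    Measurable fun z : (ZMod 4 × ℝ × ℝ × ℝ) × ℝ =>
      ∫ σ in Ioc 0 z.2, Φ z.1.1 (z.1.2 + σ • vel c z.1.1) := by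
  have hΦ' : Measurable (Function.uncurry Φ) :=
    measurable_from_prod_countable_right (f := Function.uncurry Φ) hΦ
  refine measurable_integral_Ioc
    (f := fun w : (ZMod 4 × ℝ × ℝ × ℝ) × ℝ => Φ w.1.1 (w.1.2 + w.2 • vel c w.1.1)) ?_
  exact hΦ'.comp (measurable_fst.fst.prodMk (measurable_fst.snd.add
    (measurable_snd.smul ((measurable_vel c).comp measurable_fst.fst))))

lemma integrable_comp [IsProbabilityMeasure P] {E : Type*} [NormedAddCommGroup E]
    [MeasurableSpace E] [BorelSpace E] [SecondCountableTopology E]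
    {Φ : ZMod 4 → ℝ × ℝ × ℝ → E} {C : ℝ} (hΦ : ∀ j, Measurable (Φ j)) (hC : ∀ j x, ‖Φ j x‖ ≤ C)
    {d : Ω → ZMod 4} {x : Ω → ℝ × ℝ × ℝ} (hd : Measurable d) (hx : Measurable x) :
    Integrable (fun ω => Φ (d ω) (x ω)) P :=
  Integrable.of_bound ((measurable_from_prod_countable_right (f := Function.uncurry Φ) hΦ).comp
    (hd.prodMk hx)).aestronglyMeasurable C (Eventually.of_forall fun _ => hC _ _)

lemma integrable_occ [IsProbabilityMeasure P] (hlam : 0 < lam) (hΦ : ∀ j, Measurable (Φ j))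
    (hC : ∀ j x, ‖Φ j x‖ ≤ C) (k : ℕ) : Integrable (M.occ c Φ k) P := by
  have hgap : Integrable (M.gap k) P := by
    have := integrable_id_expMeasure hlam
    rw [← M.law_gap k] at this
    exact (integrable_map_measure (by fun_prop) (M.measurable_gap k).aemeasurable).1 this
  refine (hgap.const_mul C).mono' ?_ ?_
  · refine AEStronglyMeasurable.congr ?_ (M.occ_ae_eq hlam k).symm
    exact ((measurable_integral_piece c hΦ).comp (((M.measurable_dir k).prodMk
      (M.measurable_pos c k)).prodMk (M.measurable_gap k))).aestronglyMeasurable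
  · filter_upwards [M.ae_gap_pos hlam k] with ω hω
    refine (intervalIntegral.norm_integral_le_of_norm_le_const fun σ _ => hC _ _).trans ?_
    rw [sub_zero, abs_of_pos hω]

variable [IsProbabilityMeasure P] [CompleteSpace E]

/-- At a change of direction, the mean over the turn is `turnOp`: the turn is independent of the
direction before it and of the point where it occurs. -/
lemma integral_turn (hΦ : ∀ j, Measurable (Φ j)) (hC : ∀ j x, ‖Φ j x‖ ≤ C) (k : ℕ) :
    ∫ ω, Φ (M.dir (k + 1) ω) (M.pos c (k + 1) ω) ∂P =
      ∫ ω, turnOp p q Φ (M.dir k ω) (M.pos c (k + 1) ω) ∂P := by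
  have hR : Measurable fun ω => (M.dir k ω, M.pos c (k + 1) ω) :=
    (M.measurable_dir k).prodMk (M.measurable_pos c (k + 1))
  have hΦ' : Measurable (Function.uncurry Φ) :=
    measurable_from_prod_countable_right (f := Function.uncurry Φ) hΦ
  have := Measure.isProbabilityMeasure_map (μ := P) hR.aemeasurable
  have := Measure.isProbabilityMeasure_map (μ := P) (M.measurable_turn k).aemeasurable
  set Θ : (ZMod 4 × ℝ × ℝ × ℝ) × ZMod 4 → E := fun z => Φ (z.1.1 + z.2) z.1.2 with hΘ
  have hΘm : Measurable Θ :=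
    hΦ'.comp ((measurable_add_zmod.comp (measurable_fst.fst.prodMk measurable_snd)).prodMk
      measurable_fst.snd)
  have e1 : ∫ ω, Φ (M.dir (k + 1) ω) (M.pos c (k + 1) ω) ∂P =
      ∫ ω, Θ ((M.dir k ω, M.pos c (k + 1) ω), M.turn k ω) ∂P := by simp [hΘ, dir_succ]
  have e2 : ∀ z : ZMod 4 × ℝ × ℝ × ℝ, ∫ u, Θ (z, u) ∂(P.map (M.turn k)) =
      turnOp p q Φ z.1 z.2 := by
    intro z
    have h : ∀ j, (P.map (M.turn k)).real {j} = P.real {ω | M.turn k ω = j} := fun j => by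
      rw [map_measureReal_apply (M.measurable_turn k) (measurableSet_singleton j)]
      rfl
    rw [integral_fintype Integrable.of_finite]
    have h4 : ∑ j : ZMod 4, (P.map (M.turn k)).real {j} • Θ (z, j) =
        (P.map (M.turn k)).real {0} • Θ (z, 0) + (P.map (M.turn k)).real {1} • Θ (z, 1)
        + (P.map (M.turn k)).real {2} • Θ (z, 2) + (P.map (M.turn k)).real {-1} • Θ (z, -1) :=
      Fin.sum_univ_four (fun j : ZMod 4 => (P.map (M.turn k)).real {j} • Θ (z, j))
    rw [h4, h, h, h, h, M.law_turn_zero, M.law_turn_ccw, M.law_turn_cw, M.law_turn_reflect]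
    simp only [hΘ, turnOp, zero_smul, zero_add, ← sub_eq_add_neg]
    abel
  rw [e1, ← integral_map (φ := fun ω => ((M.dir k ω, M.pos c (k + 1) ω), M.turn k ω))
    (hR.prodMk (M.measurable_turn k)).aemeasurable hΘm.aestronglyMeasurable,
    M.map_dir_pos_succ_turn, integral_prod]
  · simp only [e2]
    rw [integral_map hR.aemeasurable]
    refine Measurable.aestronglyMeasurable ?_
    exact measurable_from_prod_countable_right fun j =>
      (((hΦ _).const_smul p).add ((hΦ _).const_smul q)).add ((hΦ _).const_smul _)
  · exact Integrable.of_bound hΘm.aestronglyMeasurable C (Eventually.of_forall fun _ => hC _ _)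

/-- The mean integral of `Φ` along the `k`-th linear piece is `lam⁻¹` times the mean of `Φ` at its
end, since the piece has exponential length independent of its starting point. -/
lemma integral_occ (hlam : 0 < lam) (hΦ : ∀ j, Measurable (Φ j)) (hC : ∀ j x, ‖Φ j x‖ ≤ C)
    (k : ℕ) :
    ∫ ω, M.occ c Φ k ω ∂P = lam⁻¹ • ∫ ω, Φ (M.dir k ω) (M.pos c (k + 1) ω) ∂P := by
  have hR : Measurable fun ω => (M.dir k ω, M.pos c k ω) :=
    (M.measurable_dir k).prodMk (M.measurable_pos c k)
  have hΦ' : Measurable (Function.uncurry Φ) :=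
    measurable_from_prod_countable_right (f := Function.uncurry Φ) hΦ
  have := Measure.isProbabilityMeasure_map (μ := P) hR.aemeasurable
  have := isProbabilityMeasure_expMeasure hlam
  have hend : Measurable fun z : (ZMod 4 × ℝ × ℝ × ℝ) × ℝ => Φ z.1.1 (z.1.2 + z.2 • vel c z.1.1) :=
    hΦ'.comp (measurable_fst.fst.prodMk (measurable_fst.snd.add
      (measurable_snd.smul ((measurable_vel c).comp measurable_fst.fst))))
  have hmap : AEMeasurable (fun ω => ((M.dir k ω, M.pos c k ω), M.gap k ω)) P :=
    (hR.prodMk (M.measurable_gap k)).aemeasurable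
  rw [integral_congr_ae (M.occ_ae_eq hlam k)]
  simp only [pos_succ]
  have hint := (M.integrable_occ (c := c) hlam hΦ hC k).congr (M.occ_ae_eq hlam k)
  rw [← integral_map (φ := fun ω => ((M.dir k ω, M.pos c k ω), M.gap k ω))
      (f := fun z => ∫ σ in Ioc 0 z.2, Φ z.1.1 (z.1.2 + σ • vel c z.1.1)) hmap
      (measurable_integral_piece c hΦ).aestronglyMeasurable,
    ← integral_map (φ := fun ω => ((M.dir k ω, M.pos c k ω), M.gap k ω))
      (f := fun z => Φ z.1.1 (z.1.2 + z.2 • vel c z.1.1)) hmap hend.aestronglyMeasurable]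
  have hint' := (integrable_map_measure (f := fun ω => ((M.dir k ω, M.pos c k ω), M.gap k ω))
    (g := fun z => ∫ σ in Ioc 0 z.2, Φ z.1.1 (z.1.2 + σ • vel c z.1.1))
      (measurable_integral_piece c hΦ).aestronglyMeasurable hmap).2 hint
  rw [M.map_dir_pos_gap] at hint' ⊢
  rw [integral_prod _ hint', integral_prod, ← integral_smul]
  · congr 1
    ext z
    refine integral_expMeasure_integral (C := C) hlam (χ := fun σ => Φ z.1 (z.2 + σ • vel c z.1))
      ?_ fun _ => hC _ _
    exact (hΦ _).comp (by fun_prop)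
  · exact Integrable.of_bound hend.aestronglyMeasurable C (Eventually.of_forall fun _ => hC _ _)

end OneStep

end PlanarMotion

/-! ### Dynkin's formula -/

namespace PlanarMotion

variable {Ω : Type*} [MeasurableSpace Ω] {P : Measure Ω} [IsProbabilityMeasure P] {lam p q : ℝ}
  {E : Type*} [NormedAddCommGroup E] [NormedSpace ℝ E]

/-- The generator of the process of the direction and of `(T(t), Y(t), t)`, applied to a function
`F` whose derivative along the space-time velocities is `F'`. -/
def generator (lam p q : ℝ) (F F' : ZMod 4 → ℝ × ℝ × ℝ → E) (j : ZMod 4) (x : ℝ × ℝ × ℝ) : E :=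
  F' j x + lam • (turnOp p q F j x - F j x)

lemma norm_indicator_le_max {α E : Type*} [NormedAddCommGroup E] {s : Set α} {f : α → E} {C : ℝ}
    (h : ∀ x ∈ s, ‖f x‖ ≤ C) (x : α) : ‖s.indicator f x‖ ≤ max C 0 := by
  by_cases hx : x ∈ s
  · rw [Set.indicator_of_mem hx]
    exact (h x hx).trans (le_max_left _ _)
  · simp [Set.indicator_of_notMem hx]

variable [CompleteSpace E] [MeasurableSpace E] [BorelSpace E] [SecondCountableTopology E]

/-- The expectation of one summand of the telescoping sum behind Dynkin's formula. -/
lemma integral_occ_generator (M : PlanarMotion P lam p q) {c : ℝ} (hlam : 0 < lam) {t : ℝ}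
    {F F' : ZMod 4 → ℝ × ℝ × ℝ → E} (hFc : ∀ j, Continuous (F j)) (hF'c : ∀ j, Continuous (F' j))
    (hF : ∀ j x, HasLineDerivAt ℝ (F j) (F' j x) x (vel c j)) {C : ℝ}
    (hC : ∀ j, ∀ x ∈ strip t, ‖F j x‖ ≤ C) (hC' : ∀ j, ∀ x ∈ strip t, ‖F' j x‖ ≤ C) (k : ℕ) :
    Integrable (fun ω => {k | M.arrival k ω ≤ t ∧ t < M.arrival (k + 1) ω}.indicator
      (fun k => F (M.dir k ω) (M.state c t ω)) k) P ∧
    ∫ ω, M.occ c (fun j => (strip t).indicator (generator lam p q F F' j)) k ω ∂P =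
      ∫ ω, {k | M.arrival k ω ≤ t ∧ t < M.arrival (k + 1) ω}.indicator
          (fun k => F (M.dir k ω) (M.state c t ω)) k ∂P
        + (∫ ω, (strip t).indicator (F (M.dir (k + 1) ω)) (M.pos c (k + 1) ω) ∂P
        - ∫ ω, (strip t).indicator (F (M.dir k ω)) (M.pos c k ω) ∂P) := by
  set SF : ZMod 4 → ℝ × ℝ × ℝ → E := fun j => (strip t).indicator (F j) with hSF
  set SF' : ZMod 4 → ℝ × ℝ × ℝ → E := fun j => (strip t).indicator (F' j) with hSF'
  have mSF : ∀ j, Measurable (SF j) := fun j => (hFc j).measurable.indicator (measurableSet_strip t)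
  have mSF' : ∀ j, Measurable (SF' j) := fun j =>
    (hF'c j).measurable.indicator (measurableSet_strip t)
  have bSF : ∀ j x, ‖SF j x‖ ≤ max C 0 := fun j => norm_indicator_le_max (hC j)
  have bSF' : ∀ j x, ‖SF' j x‖ ≤ max C 0 := fun j => norm_indicator_le_max (hC' j)
  have mQ : ∀ j, Measurable (turnOp p q SF j) := fun j =>
    (((mSF _).const_smul p).add ((mSF _).const_smul q)).add ((mSF _).const_smul _)
  have bQ : ∀ j x, ‖turnOp p q SF j x‖ ≤ (|p| + |q| + |1 - p - q|) * max C 0 := by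
    intro j x
    refine (norm_add₃_le).trans ?_
    rw [norm_smul, norm_smul, norm_smul, Real.norm_eq_abs, Real.norm_eq_abs, Real.norm_eq_abs,
      add_mul, add_mul]
    gcongr <;> exact bSF _ _
  set J : ZMod 4 → ℝ × ℝ × ℝ → E := fun j x => turnOp p q SF j x - SF j x with hJ
  have mJ : ∀ j, Measurable (J j) := fun j => (mQ j).sub (mSF j)
  have bJ : ∀ j x, ‖J j x‖ ≤ (|p| + |q| + |1 - p - q|) * max C 0 + max C 0 := fun j x =>
    (norm_sub_le _ _).trans (add_le_add (bQ j x) (bSF j x))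
  have iSF : ∀ k l, Integrable (fun ω => SF (M.dir k ω) (M.pos c l ω)) P := fun k l =>
    integrable_comp mSF bSF (M.measurable_dir k) (M.measurable_pos c l)
  have iQ : Integrable (fun ω => turnOp p q SF (M.dir k ω) (M.pos c (k + 1) ω)) P :=
    integrable_comp mQ bQ (M.measurable_dir k) (M.measurable_pos c _)
  have iO := M.integrable_occ (c := c) hlam mSF' bSF' k
  have iOJ := M.integrable_occ (c := c) hlam mJ bJ k
  have hpath : (fun ω => {k | M.arrival k ω ≤ t ∧ t < M.arrival (k + 1) ω}.indicator
      (fun k => F (M.dir k ω) (M.state c t ω)) k) =ᵐ[P] fun ω =>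
      M.occ c SF' k ω - SF (M.dir k ω) (M.pos c (k + 1) ω) + SF (M.dir k ω) (M.pos c k ω) := by
    filter_upwards [M.ae_good hlam] with ω hω
    rw [hω.occ_indicator_deriv hF'c hF]
    abel
  have hocc : M.occ c (fun j => (strip t).indicator (generator lam p q F F' j)) k =ᵐ[P]
      fun ω => M.occ c SF' k ω + lam • M.occ c J k ω := by
    have hfun : (fun j => (strip t).indicator (generator lam p q F F' j)) =
        fun j x => SF' j x + lam • J j x := by
      ext j x
      by_cases hx : x ∈ strip t
      · simp [generator, hSF', hJ, hSF, turnOp, hx]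
      · simp [hSF', hJ, hSF, turnOp, hx]
    filter_upwards with ω
    rw [hfun]
    simp only [occ]
    have hII : ∀ {Φ : ZMod 4 → ℝ × ℝ × ℝ → E} {B : ℝ}, (∀ j, Measurable (Φ j)) →
        (∀ j x, ‖Φ j x‖ ≤ B) → IntervalIntegrable (fun σ : ℝ => Φ (M.dir k ω)
          (M.pos c k ω + σ • vel c (M.dir k ω))) volume 0 (M.gap k ω) := by
      intro Φ B hm hb
      rw [intervalIntegrable_iff]
      refine Measure.integrableOn_of_bounded (M := B) (by simp) ?_
        (Eventually.of_forall fun _ => hb _ _)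
      exact ((hm _).comp (by fun_prop)).aestronglyMeasurable
    have hadd := intervalIntegral.integral_add (hII mSF' bSF') ((hII mJ bJ).smul lam)
    simp only [Pi.smul_apply, intervalIntegral.integral_smul] at hadd
    exact hadd
  refine ⟨((iO.sub (iSF _ _)).add (iSF _ _)).congr hpath.symm, ?_⟩
  have hadd := integral_add iO (iOJ.smul lam)
  simp only [Pi.smul_apply, integral_smul] at hadd
  have hsub := integral_add (iO.sub (iSF k (k + 1))) (iSF k k)
  simp only [Pi.sub_apply, integral_sub iO (iSF k (k + 1))] at hsub
  -- the factor `lam⁻¹` of the exponential piece cancels the rate of the jumps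
  rw [integral_congr_ae hocc, integral_congr_ae hpath, hadd, M.integral_occ hlam mJ bJ, smul_smul,
    mul_inv_cancel₀ hlam.ne', one_smul, hsub, integral_sub iQ (iSF _ _), M.integral_turn mSF bSF]
  abel

/-- **Dynkin's formula** for the planar motion. Between two changes of direction the formula is the
fundamental theorem of calculus, the changes of direction contribute the jump part of the generator,
and the contributions telescope. -/
theorem dynkin (M : PlanarMotion P lam p q) {c : ℝ} (hlam : 0 < lam) {t : ℝ} (ht : 0 ≤ t)
    {F F' : ZMod 4 → ℝ × ℝ × ℝ → E} (hFc : ∀ j, Continuous (F j)) (hF'c : ∀ j, Continuous (F' j))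
    (hF : ∀ j x, HasLineDerivAt ℝ (F j) (F' j x) x (vel c j)) {C : ℝ}
    (hC : ∀ j, ∀ x ∈ strip t, ‖F j x‖ ≤ C) (hC' : ∀ j, ∀ x ∈ strip t, ‖F' j x‖ ≤ C) :
    ∫ ω, F (M.D t ω) (M.state c t ω) ∂P = ∫ ω, F (M.D₀ ω) 0 ∂P +
      ∫ ω, (∫ τ in (0 : ℝ)..t, generator lam p q F F' (M.D τ ω) (M.state c τ ω)) ∂P := by
  set SF : ZMod 4 → ℝ × ℝ × ℝ → E := fun j => (strip t).indicator (F j) with hSF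
  set G := generator lam p q F F' with hG
  have mG : ∀ j, Measurable (G j) := fun j => (hF'c j).measurable.add
    ((((((hFc _).measurable.const_smul p).add ((hFc _).measurable.const_smul q)).add
      ((hFc _).measurable.const_smul _)).sub (hFc _).measurable).const_smul lam)
  obtain ⟨B, hB0, bG⟩ : ∃ B, 0 ≤ B ∧ ∀ j, ∀ x ∈ strip t, ‖G j x‖ ≤ B := by
    have hC0 : 0 ≤ C := (norm_nonneg _).trans (hC 0 0 ⟨le_rfl, ht⟩)
    refine ⟨C + |lam| * ((|p| * C + |q| * C + |1 - p - q| * C) + C), by positivity,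
      fun j x hx => ?_⟩
    refine (norm_add_le _ _).trans (add_le_add (hC' j x hx) ?_)
    rw [norm_smul, Real.norm_eq_abs]
    refine mul_le_mul_of_nonneg_left ?_ (abs_nonneg _)
    refine (norm_sub_le _ _).trans (add_le_add ((norm_add₃_le).trans ?_) (hC j x hx))
    rw [norm_smul, norm_smul, norm_smul, Real.norm_eq_abs, Real.norm_eq_abs, Real.norm_eq_abs]
    gcongr <;> exact hC _ x hx
  have mSG : ∀ j, Measurable ((strip t).indicator (G j)) := fun j =>
    (mG j).indicator (measurableSet_strip t)
  have bSG : ∀ j x, ‖(strip t).indicator (G j) x‖ ≤ max B 0 := fun j =>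
    norm_indicator_le_max (bG j)
  have mSF : ∀ j, Measurable (SF j) := fun j => (hFc j).measurable.indicator (measurableSet_strip t)
  have bSF : ∀ j x, ‖SF j x‖ ≤ max C 0 := fun j => norm_indicator_le_max (hC j)
  have hstep := M.integral_occ_generator hlam hFc hF'c hF hC hC'
  -- the telescoping sum of the first `K` pieces
  have hsum : ∀ K, ∫ ω, ∑ k ∈ Finset.range K, M.occ c (fun j => (strip t).indicator (G j)) k ω ∂P =
      ∫ ω, ∑ k ∈ Finset.range K, {k | M.arrival k ω ≤ t ∧ t < M.arrival (k + 1) ω}.indicator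
        (fun k => F (M.dir k ω) (M.state c t ω)) k ∂P +
      (∫ ω, SF (M.dir K ω) (M.pos c K ω) ∂P - ∫ ω, SF (M.dir 0 ω) (M.pos c 0 ω) ∂P) := by
    intro K
    rw [integral_finsetSum _ fun k _ => M.integrable_occ hlam mSG bSG k,
      integral_finsetSum _ fun k _ => (hstep k).1, Finset.sum_congr rfl fun k _ => (hstep k).2,
      Finset.sum_add_distrib,
      Finset.sum_range_sub fun k => ∫ ω, SF (M.dir k ω) (M.pos c k ω) ∂P]
  have lim1 : Tendsto (fun K => ∫ ω, ∑ k ∈ Finset.range K,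
      M.occ c (fun j => (strip t).indicator (G j)) k ω ∂P) atTop
      (𝓝 (∫ ω, (∫ τ in (0 : ℝ)..t, G (M.D τ ω) (M.state c τ ω)) ∂P)) := by
    refine tendsto_integral_of_dominated_convergence (fun _ => B * t) ?_ (integrable_const _) ?_ ?_
    · exact fun K => (integrable_finsetSum _
        fun k _ => M.integrable_occ hlam mSG bSG k).aestronglyMeasurable
    · intro K
      filter_upwards [M.ae_good hlam] with ω hω
      rw [hω.sum_occ_indicator ht mG bG]
      have hm : 0 ≤ min (M.arrival K ω) t := le_min (hω.arrival_nonneg K) ht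
      refine (intervalIntegral.norm_integral_le_of_norm_le_const (C := B) fun τ hτ => ?_).trans ?_
      · rw [Set.uIoc_of_le hm] at hτ
        exact bG _ _ ⟨hτ.1.le, hτ.2.trans (min_le_right _ _)⟩
      · rw [sub_zero, abs_of_nonneg hm]
        exact mul_le_mul_of_nonneg_left (min_le_right _ _) hB0
    · filter_upwards [M.ae_good hlam] with ω hω
      refine tendsto_const_nhds.congr' ?_
      filter_upwards [hω.2.eventually_ge_atTop t] with K hK
      rw [hω.sum_occ_indicator ht mG bG, min_eq_right hK]
  have lim2 : Tendsto (fun K => ∫ ω, ∑ k ∈ Finset.range K,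
      {k | M.arrival k ω ≤ t ∧ t < M.arrival (k + 1) ω}.indicator
        (fun k => F (M.dir k ω) (M.state c t ω)) k ∂P) atTop
      (𝓝 (∫ ω, F (M.D t ω) (M.state c t ω) ∂P)) := by
    refine tendsto_integral_of_dominated_convergence (fun _ => max C 0) ?_ (integrable_const _)
      ?_ ?_
    · exact fun K => (integrable_finsetSum _ fun k _ => (hstep k).1).aestronglyMeasurable
    · intro K
      filter_upwards [M.ae_good hlam] with ω hω
      rw [hω.sum_indicator_arrival ht fun j => F j (M.state c t ω)]
      exact norm_indicator_le_max (fun K _ => hC _ _ ⟨ht, le_rfl⟩) K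
    · filter_upwards [M.ae_good hlam] with ω hω
      refine tendsto_const_nhds.congr' ?_
      filter_upwards [hω.2.eventually_gt_atTop t] with K hK
      rw [hω.sum_indicator_arrival ht fun j => F j (M.state c t ω)]
      exact (Set.indicator_of_mem (s := {K | t < M.arrival K ω}) hK
        fun _ => F (M.D t ω) (M.state c t ω)).symm
  -- the boundary term vanishes, since the `K`-th change of direction is eventually after time `t`
  have lim3 : Tendsto (fun K => ∫ ω, SF (M.dir K ω) (M.pos c K ω) ∂P) atTop (𝓝 0) := by
    rw [← integral_zero Ω E (μ := P)]
    refine tendsto_integral_of_dominated_convergence (fun _ => max C 0) ?_ (integrable_const _)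
      ?_ ?_
    · exact fun K => (integrable_comp mSF bSF (M.measurable_dir K)
        (M.measurable_pos c K)).aestronglyMeasurable
    · exact fun K => Eventually.of_forall fun ω => bSF _ _
    · filter_upwards [M.ae_good hlam] with ω hω
      refine tendsto_const_nhds.congr' ?_
      filter_upwards [hω.2.eventually_gt_atTop t] with K hK
      exact (Set.indicator_of_notMem (fun h => by
        rw [hω.pos_mem_strip_iff] at h; linarith) _).symm
  have hlim := tendsto_nhds_unique lim1 ((lim2.add (lim3.sub_const _)).congr fun K => (hsum K).symm)
  have h0 : ∫ ω, SF (M.dir 0 ω) (M.pos c 0 ω) ∂P = ∫ ω, F (M.D₀ ω) 0 ∂P := by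
    congr 1
    ext ω
    have : (0 : ℝ × ℝ × ℝ) ∈ strip t := ⟨le_rfl, ht⟩
    simp [hSF, dir, pos, this]
  rw [hlim, h0]
  abel

end PlanarMotion

/-! ### The law of the motion as a distribution -/

namespace PlanarMotion

variable {Ω : Type*} [MeasurableSpace Ω] {P : Measure Ω} {lam p q : ℝ}

/-- The state `(T(t), Y(t), t)` as the sum of the displacements along the linear pieces of the path
started before time `t`, for `t` up to the `K`-th change of direction. -/
lemma Good.sum_smul_vel {M : PlanarMotion P lam p q} {c : ℝ} {ω : Ω} (h : M.Good ω) {t : ℝ}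
    (ht : 0 ≤ t) (K : ℕ) :
    ∑ k ∈ Finset.range K, max 0 (min (t - M.arrival k ω) (M.gap k ω)) • vel c (M.dir k ω) =
      if M.arrival K ω ≤ t then M.pos c K ω else M.state c t ω := by
  induction K with
  | zero => simp [arrival_zero, ht, pos_zero]
  | succ K ih =>
    have hs := M.arrival_succ K ω
    have hg := h.1 K
    rw [Finset.sum_range_succ, ih]
    rcases lt_or_ge t (M.arrival K ω) with h1 | h1
    · rw [if_neg (by linarith), if_neg (by linarith), max_eq_left, zero_smul, add_zero]
      exact (min_le_left _ _).trans (by linarith)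
    · rw [if_pos h1]
      rcases lt_or_ge t (M.arrival (K + 1) ω) with h2 | h2
      · rw [if_neg (by linarith), min_eq_left (by linarith), max_eq_right (by linarith),
          h.state_eq h1 h2.le]
      · rw [if_pos h2, min_eq_right (by linarith), max_eq_right (by linarith), pos_succ]

variable [IsProbabilityMeasure P] (M : PlanarMotion P lam p q)

/-- The path is jointly measurable in time and chance: it is almost surely the limit of the
measurable sums of `Good.sum_smul_vel`. -/
lemma aemeasurable_uncurry_state (hlam : 0 < lam) (c : ℝ) {ν : Measure ℝ} [SFinite ν]
    (hν : ∀ᵐ t ∂ν, 0 ≤ t) :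
    AEMeasurable (fun z : ℝ × Ω => M.state c z.1 z.2) (ν.prod P) := by
  refine aemeasurable_of_tendsto_metrizable_ae atTop (f := fun K (z : ℝ × Ω) =>
    ∑ k ∈ Finset.range K, max 0 (min (z.1 - M.arrival k z.2) (M.gap k z.2)) •
      vel c (M.dir k z.2)) (fun K => Measurable.aemeasurable ?_) ?_
  · refine Finset.measurable_fun_sum _ fun k _ => Measurable.fun_smul ?_ ?_
    · exact measurable_const.max ((measurable_fst.sub
        ((M.measurable_arrival k).comp measurable_snd)).min
        ((M.measurable_gap k).comp measurable_snd))
    · exact (measurable_vel c).comp ((M.measurable_dir k).comp measurable_snd)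
  · filter_upwards [Measure.quasiMeasurePreserving_snd.ae (M.ae_good hlam),
      Measure.quasiMeasurePreserving_fst.ae hν] with z hz hz0
    refine tendsto_const_nhds.congr' ?_
    filter_upwards [hz.2.eventually_gt_atTop z.1] with K hK
    rw [hz.sum_smul_vel hz0, if_neg (by linarith)]

lemma aemeasurable_state (hlam : 0 < lam) (c : ℝ) {t : ℝ} (ht : 0 ≤ t) :
    AEMeasurable (M.state c t) P := by
  have h := M.aemeasurable_uncurry_state hlam c (ν := Measure.dirac t)
    (by rw [ae_dirac_eq]; exact ht)
  rw [Measure.dirac_prod] at h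
  exact h.comp_measurable measurable_prodMk_left

end PlanarMotion

section Distributions

variable {Ω : Type*} [MeasurableSpace Ω] {P : Measure Ω} [IsProbabilityMeasure P]
  {Z : ℝ → Ω → ℝ × ℝ × ℝ}

/-- The measure `ℙ(Z(t) ∈ dx) dt` of a space-time process is finite on compact sets. -/
lemma isFiniteMeasureOnCompacts_map
    (hZ : AEMeasurable (fun z : ℝ × Ω => Z z.1 z.2) ((volume.restrict (Ioi 0)).prod P))
    (hZt : ∀ t ω, (Z t ω).2.2 = t) : IsFiniteMeasureOnCompacts
      (((volume.restrict (Ioi (0 : ℝ))).prod P).map fun z : ℝ × Ω => Z z.1 z.2) := by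
  refine ⟨fun K hK => ?_⟩
  obtain ⟨b, hb⟩ := (hK.image (continuous_snd.comp continuous_snd)).bddAbove
  rw [Measure.map_apply_of_aemeasurable hZ hK.measurableSet]
  calc _ ≤ ((volume.restrict (Ioi (0 : ℝ))).prod P) (Iic b ×ˢ Set.univ) := by
        refine measure_mono fun z hz => ⟨?_, trivial⟩
        have := hb (Set.mem_image_of_mem _ hz)
        simpa [hZt] using this
    _ < ⊤ := by
        rw [Measure.prod_prod, measure_univ, mul_one, Measure.restrict_apply measurableSet_Iic,
          inter_comm, Ioi_inter_Iic]
        simp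

lemma integrable_testFunction_comp
    (hZ : AEMeasurable (fun z : ℝ × Ω => Z z.1 z.2) ((volume.restrict (Ioi 0)).prod P))
    (hZt : ∀ t ω, (Z t ω).2.2 = t) (φ : 𝓓(halfSpace, ℝ)) :
    Integrable (fun z : ℝ × Ω => φ (Z z.1 z.2)) ((volume.restrict (Ioi 0)).prod P) := by
  have := isFiniteMeasureOnCompacts_map hZ hZt
  exact (integrable_map_measure φ.aestronglyMeasurable hZ).1
    (φ.continuous.integrable_of_hasCompactSupport φ.hasCompactSupport)

/-- The law of a space-time process defines a distribution. -/
lemma exists_distribution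
    (hZ : AEMeasurable (fun z : ℝ × Ω => Z z.1 z.2) ((volume.restrict (Ioi 0)).prod P))
    (hZt : ∀ t ω, (Z t ω).2.2 = t) :
    ∃ u : 𝓓'(halfSpace, ℝ), ∀ φ : 𝓓(halfSpace, ℝ),
      u φ = ∫ t in Ioi (0 : ℝ), ∫ ω, φ (Z t ω) ∂P := by
  have := isFiniteMeasureOnCompacts_map hZ hZt
  set μ := ((volume.restrict (Ioi (0 : ℝ))).prod P).map fun z : ℝ × Ω => Z z.1 z.2 with hμ
  refine ⟨TestFunction.integralAgainstBilinCLM (ContinuousLinearMap.mul ℝ ℝ) μ fun _ => 1,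
    fun φ => ?_⟩
  have hloc : LocallyIntegrableOn (fun _ : ℝ × ℝ × ℝ => (1 : ℝ)) halfSpace μ :=
    (locallyIntegrable_const 1).locallyIntegrableOn _
  refine (TestFunction.integralAgainstBilinCLM_eq_integral hloc).trans ?_
  simp only [ContinuousLinearMap.mul_apply', mul_one]
  rw [hμ, integral_map hZ φ.aestronglyMeasurable,
    integral_prod _ (integrable_testFunction_comp hZ hZt φ)]

end Distributions

/-! ### The equation of the joint density -/

lemma PlanarMotion.vel_values (c : ℝ) : vel c 0 = (0, 0, 1) ∧ vel c 1 = (1, c, 1) ∧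
    vel c 2 = (0, 0, 1) ∧ vel c 3 = (1, -c, 1) := by
  have hval : (0 : ZMod 4).val = 0 ∧ (1 : ZMod 4).val = 1 ∧ (2 : ZMod 4).val = 2 ∧
    (3 : ZMod 4).val = 3 := by decide
  have hsin : Real.sin (Real.pi / 2 * 3) = -1 := by
    rw [show Real.pi / 2 * 3 = Real.pi / 2 + Real.pi by ring, Real.sin_add_pi, Real.sin_pi_div_two]
  have h : (0 : ZMod 4) ≠ 1 ∧ (0 : ZMod 4) ≠ 3 ∧ (2 : ZMod 4) ≠ 1 ∧ (2 : ZMod 4) ≠ 3 := by decide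
  obtain ⟨h0, h1, h2, h3⟩ := hval
  obtain ⟨a, b, d, e⟩ := h
  simp [vel, h0, h1, h2, h3, hsin, a, b, d, e]

section Corrector

/-- Four symbols, one for each direction, which the generator of the motion maps to `-jointPoly`,
whatever the direction. Here `s`, `y`, `t` stand for minus the derivatives. They are
the row sums of the adjugate of the `4 × 4` matrix of minus the generator, whose determinant is
`jointPoly`. -/
lemma exists_adjugate_comm {R : Type*} [CommRing R] [Algebra ℝ R] (s y t : R)
    (lam c p q : ℝ) :
    ∃ f : Fin 4 → R,
      (t + lam • 1) * f 0 = lam • (p • f 1 + q • f 3 + (1 - p - q) • f 2)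
        + jointPoly s y t lam c p q ∧
      (t + s + c • y + lam • 1) * f 1 = lam • (p • f 2 + q • f 0 + (1 - p - q) • f 3)
        + jointPoly s y t lam c p q ∧
      (t + lam • 1) * f 2 = lam • (p • f 3 + q • f 1 + (1 - p - q) • f 0)
        + jointPoly s y t lam c p q ∧
      (t + s + (-c) • y + lam • 1) * f 3 = lam • (p • f 0 + q • f 2 + (1 - p - q) • f 1)
        + jointPoly s y t lam c p q := by
  set A := t + lam • (1 : R) with hA
  set B := t + lam • (1 : R) + s with hB
  set ρ : R := (lam * (1 - p - q)) • (1 : R) with hρ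
  set G := (A + ρ) * (B + ρ) + (lam ^ 2 * (p - q) ^ 2) • (1 : R) with hG
  set κ := A - ρ + (lam * (p + q)) • (1 : R) with hκ
  -- the even and odd parts of `f` in each of the two pairs of opposite directions
  set x := (B - ρ) * G - c ^ 2 • (y ^ 2 * (A + ρ)) + (lam * (p + q)) • G with hx
  set v := -((lam * (p - q) * c) • (y * κ)) with hv
  set z := G * κ with hz
  set w := -(c • (y * ((A + ρ) * κ))) with hw
  refine ⟨![x + v, z + w, x - v, z - w], ?_, ?_, ?_, ?_⟩ <;>
  · simp only [Matrix.cons_val_zero, Matrix.cons_val_one, Matrix.cons_val]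
    simp only [hx, hv, hz, hw, hG, hκ, hρ, hA, hB, jointPoly]
    algebra

/-- The same as `exists_adjugate_comm` for commuting elements of an arbitrary algebra, written
uniformly in the direction. -/
lemma exists_adjugate {A : Type*} [Ring A] [Algebra ℝ A] (s y t : A)
    (hsy : Commute s y) (hst : Commute s t) (hyt : Commute y t) (lam c p q : ℝ) :
    ∃ f : ZMod 4 → A, ∀ j,
      ((PlanarMotion.vel c j).1 • s + (PlanarMotion.vel c j).2.1 • y + t + lam • 1) * f j =
        lam • (p • f (j + 1) + q • f (j - 1) + (1 - p - q) • f (j + 2))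
          + jointPoly s y t lam c p q := by
  obtain ⟨S, hS, s, y, t, rfl, rfl, rfl⟩ := exists_commRing_algHom s y t hsy hst hyt
  let _ : CommRing S := { (inferInstance : Ring S) with mul_comm := fun a b => hS.1.comm a b }
  have hpoly : S.val (jointPoly s y t lam c p q) = jointPoly (s : A) (y : A) (t : A) lam c p q := by
    simp [jointPoly]
  obtain ⟨f, h0, h1, h2, h3⟩ := exists_adjugate_comm s y t lam c p q
  have k0 := congrArg S.val h0
  have k1 := congrArg S.val h1
  have k2 := congrArg S.val h2
  have k3 := congrArg S.val h3
  simp only [map_mul, map_add, map_smul S.val, map_one, hpoly] at k0 k1 k2 k3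
  obtain ⟨v0, v1, v2, v3⟩ := PlanarMotion.vel_values c
  refine ⟨fun j => (f j : A), fun j => ?_⟩
  have hj : j = 0 ∨ j = 1 ∨ j = 2 ∨ j = 3 := by revert j; decide
  rcases hj with rfl | rfl | rfl | rfl
  · simp only [v0, zero_smul, zero_add]
    exact k0
  · simp only [v1, one_smul]
    rw [show (s : A) + c • (y : A) + t = t + s + c • (y : A) by abel]
    exact k1
  · simp only [v2, zero_smul, zero_add]
    exact k2
  · simp only [v3, one_smul]
    rw [show (s : A) + (-c) • (y : A) + t = t + s + (-c) • (y : A) by abel]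
    exact k3

end Corrector

section JointDensity

variable {Ω : Type*} [MeasurableSpace Ω] {P : Measure Ω} [IsProbabilityMeasure P]
  {lam c p q : ℝ}

/-- The support of a test function is bounded in time. -/
lemma eventually_testFunction_eq_zero {U : Opens (ℝ × ℝ × ℝ)} (φ : 𝓓(U, ℝ)) :
    ∀ᶠ R in atTop, ∀ x : ℝ × ℝ × ℝ, R ≤ x.2.2 → φ x = 0 := by
  obtain ⟨b, hb⟩ := (φ.hasCompactSupport.isCompact.image
    (continuous_snd.comp continuous_snd)).bddAbove
  filter_upwards [eventually_gt_atTop b] with R hR x hx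
  by_contra hne
  have := hb (Set.mem_image_of_mem _ (subset_tsupport _ hne))
  simp only [Function.comp_apply] at this
  linarith

lemma testFunction_eq_zero_of_time_nonpos (φ : 𝓓(halfSpace, ℝ)) {x : ℝ × ℝ × ℝ} (hx : x.2.2 ≤ 0) :
    φ x = 0 := by
  by_contra hne
  have : 0 < x.2.2 := φ.tsupport_subset (subset_tsupport _ hne)
  linarith

/-- The joint density solves the fourth-order equation: tested against `φ`, the equation is Dynkin's
formula for the functions obtained from `φ` by `exists_adjugate`, up to a time after which they
vanish. -/
lemma jointOp_eq_zero (M : PlanarMotion P lam p q) (hlam : 0 < lam) {u : 𝓓'(halfSpace, ℝ)}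
    (hu : IsJointDensity M c u) : jointOp halfSpace lam c p q u = 0 := by
  ext φ
  rw [isTransposeOf_jointTestOp lam c p q u φ, hu]
  set ψ := jointTestOp halfSpace lam c p q φ with hψ
  set s := -testDeriv halfSpace (1, 0, 0) with hs
  set y := -testDeriv halfSpace (0, 1, 0) with hy
  set t := -testDeriv halfSpace (0, 0, 1) with ht
  obtain ⟨f, hf⟩ := exists_adjugate s y t
    (testDeriv_commute _ _).neg_left.neg_right (testDeriv_commute _ _).neg_left.neg_right
    (testDeriv_commute _ _).neg_left.neg_right lam c p q
  set F : ZMod 4 → 𝓓(halfSpace, ℝ) := fun j => f j φ with hF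
  set F' : ZMod 4 → 𝓓(halfSpace, ℝ) := fun j =>
    -((PlanarMotion.vel c j).1 • s + (PlanarMotion.vel c j).2.1 • y + t) (F j) with hF'
  -- on the vector `F`, the generator acts as `-ψ`, whatever the direction
  have hgen : ∀ j x, PlanarMotion.generator lam p q (fun j => F j) (fun j => F' j) j x = -ψ x := by
    intro j x
    have h := DFunLike.congr_fun (DFunLike.congr_fun (hf j) φ) x
    change _ = lam * (p * F (j + 1) x + q * F (j - 1) x + (1 - p - q) * F (j + 2) x) + ψ x at h
    have h' : ((PlanarMotion.vel c j).1 • s + (PlanarMotion.vel c j).2.1 • y + t + lam • 1)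
        (F j) x = -F' j x + lam * F j x := by
      rw [hF', LinearMap.add_apply]
      simp
    change ((PlanarMotion.vel c j).1 • s + (PlanarMotion.vel c j).2.1 • y + t + lam • 1) (F j) x = _
      at h
    rw [h'] at h
    simp only [PlanarMotion.generator, PlanarMotion.turnOp, smul_eq_mul]
    linarith
  have hderiv : ∀ j x, HasLineDerivAt ℝ (F j) (F' j x) x (PlanarMotion.vel c j) := by
    intro j x
    have hd : DifferentiableAt ℝ (F j) x := (F j).contDiff.differentiable (by simp) x
    have hv : PlanarMotion.vel c j = (PlanarMotion.vel c j).1 • ((1, 0, 0) : ℝ × ℝ × ℝ) +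
        (PlanarMotion.vel c j).2.1 • ((0, 1, 0) : ℝ × ℝ × ℝ) + (0, 0, 1) := by
      ext <;> simp [PlanarMotion.vel]
    have e : F' j x = fderiv ℝ (F j) x (PlanarMotion.vel c j) := by
      conv_rhs => rw [hv]
      rw [map_add, map_add, map_smul, map_smul, ← testDeriv_apply, ← testDeriv_apply,
        ← testDeriv_apply, hF']
      simp [hs, hy, ht]
      ring
    rw [e]
    exact hd.hasFDerivAt.hasLineDerivAt (PlanarMotion.vel c j)
  -- a time `R` after which all the functions involved vanish
  obtain ⟨R, hR0, hRF, hRψ⟩ := ((eventually_ge_atTop (0 : ℝ)).and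
    ((eventually_all.2 fun j => eventually_testFunction_eq_zero (F j)).and
      (eventually_testFunction_eq_zero ψ))).exists
  have hbdd : ∀ g : ZMod 4 → 𝓓(halfSpace, ℝ), ∃ C, ∀ j x, ‖g j x‖ ≤ C := by
    intro g
    choose C hC using fun j => (g j).continuous.bounded_above_of_compact_support
      (g j).hasCompactSupport
    obtain ⟨B, hB⟩ := (Set.finite_range C).bddAbove
    exact ⟨B, fun j x => (hC j x).trans (hB (Set.mem_range_self j))⟩
  obtain ⟨C₁, hC₁⟩ := hbdd F
  obtain ⟨C₂, hC₂⟩ := hbdd F'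
  have key := M.dynkin hlam hR0 (F := fun j => F j) (F' := fun j => F' j)
    (fun j => (F j).continuous) (fun j => (F' j).continuous) hderiv (C := max C₁ C₂)
    (fun j x _ => (hC₁ j x).trans (le_max_left _ _))
    (fun j x _ => (hC₂ j x).trans (le_max_right _ _))
  have e1 : ∀ ω, F (M.D R ω) (M.state c R ω) = 0 := fun ω => hRF _ _ le_rfl
  have e2 : ∀ ω, F (M.D₀ ω) 0 = 0 := fun ω => testFunction_eq_zero_of_time_nonpos _ le_rfl
  simp only [e1, e2, hgen, integral_zero, zero_add, intervalIntegral.integral_neg,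
    integral_neg] at key
  have hint := integrable_testFunction_comp (Z := fun t ω => M.state c t ω)
    (M.aemeasurable_uncurry_state hlam c (ae_restrict_of_forall_mem measurableSet_Ioi
      fun t ht => le_of_lt ht)) (fun _ _ => rfl) ψ
  change ∫ t in Ioi (0 : ℝ), ∫ ω, ψ (M.state c t ω) ∂P = 0
  rw [integral_integral_swap hint]
  have e3 : ∀ ω, ∫ τ in Ioi (0 : ℝ), ψ (M.state c τ ω) = ∫ τ in (0 : ℝ)..R, ψ (M.state c τ ω) := by
    intro ω
    rw [intervalIntegral.integral_of_le hR0]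
    refine setIntegral_eq_of_subset_of_forall_sdiff_eq_zero measurableSet_Ioi Ioc_subset_Ioi_self ?_
    rintro τ ⟨hτ, hτ'⟩
    refine hRψ _ (not_lt.1 fun h => hτ' ⟨hτ, le_of_lt h⟩)
  simp only [e3]
  linarith

end JointDensity

/-! ### Expectations of exponentials -/

namespace PlanarMotion

variable {Ω : Type*} [MeasurableSpace Ω] {P : Measure Ω} [IsProbabilityMeasure P] {lam p q : ℝ}

lemma aemeasurable_comp_D (M : PlanarMotion P lam p q) (hlam : 0 < lam) {t : ℝ} (ht : 0 ≤ t)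
    (g : ZMod 4 → ℂ) : AEMeasurable (fun ω => g (M.D t ω)) P := by
  refine aemeasurable_of_tendsto_metrizable_ae atTop (f := fun K ω => ∑ k ∈ Finset.range K,
    {ω | M.arrival k ω ≤ t ∧ t < M.arrival (k + 1) ω}.indicator (fun ω => g (M.dir k ω)) ω)
    (fun K => Measurable.aemeasurable ?_) ?_
  · refine Finset.measurable_fun_sum _ fun k _ => Measurable.indicator ?_ ?_
    · exact (measurable_of_countable g).comp (M.measurable_dir k)
    · exact (measurableSet_le (M.measurable_arrival k) measurable_const).inter
        (measurableSet_lt measurable_const (M.measurable_arrival (k + 1)))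
  · filter_upwards [M.ae_good hlam] with ω hω
    refine tendsto_const_nhds.congr' ?_
    filter_upwards [hω.2.eventually_gt_atTop t] with K hK
    have h := hω.sum_indicator_arrival ht g K
    rw [Set.indicator_of_mem (s := {K | t < M.arrival K ω}) hK] at h
    exact h.symm

/-- The exponential `exp (i (α s + β y) - μ t)` of the space-time point `(s, y, t)`. -/
def expFun (α β : ℝ) (μ : ℂ) (x : ℝ × ℝ × ℝ) : ℂ :=
  Complex.exp (Complex.I * (α * x.1 + β * x.2.1) - μ * x.2.2)

lemma norm_expFun_le {α β t : ℝ} {μ : ℂ} {x : ℝ × ℝ × ℝ} (hx : x ∈ strip t) :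
    ‖expFun α β μ x‖ ≤ Real.exp (‖μ‖ * t) := by
  rw [expFun, Complex.norm_exp]
  gcongr
  have h1 : (Complex.I * (α * x.1 + β * x.2.1) - μ * x.2.2 : ℂ).re = -(μ.re * x.2.2) := by
    simp
  rw [h1]
  calc -(μ.re * x.2.2) = (-μ.re) * x.2.2 := by ring
    _ ≤ ‖μ‖ * x.2.2 := mul_le_mul_of_nonneg_right
        ((neg_le_abs _).trans (Complex.abs_re_le_norm μ)) hx.1
    _ ≤ ‖μ‖ * t := mul_le_mul_of_nonneg_left hx.2 (norm_nonneg _)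

lemma continuous_expFun (α β : ℝ) (μ : ℂ) : Continuous (expFun α β μ) := by
  unfold expFun
  fun_prop

lemma hasLineDerivAt_expFun (α β : ℝ) (μ : ℂ) (x v : ℝ × ℝ × ℝ) :
    HasLineDerivAt ℝ (expFun α β μ)
      ((Complex.I * (α * v.1 + β * v.2.1) - μ * v.2.2) * expFun α β μ x) x v := by
  unfold HasLineDerivAt
  have h : HasDerivAt (fun τ : ℝ => (Complex.I * (α * x.1 + β * x.2.1) - μ * x.2.2) +
      (τ : ℂ) * (Complex.I * (α * v.1 + β * v.2.1) - μ * v.2.2))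
      (1 * (Complex.I * (α * v.1 + β * v.2.1) - μ * v.2.2)) 0 :=
    ((Complex.ofRealCLM.hasDerivAt (x := (0 : ℝ))).mul_const _).const_add _
  have h2 := h.cexp
  simp only [Complex.ofReal_zero, zero_mul, add_zero, one_mul] at h2
  rw [mul_comm]
  refine h2.congr_of_eventuallyEq (Eventually.of_forall fun τ => ?_)
  simp only [expFun, Prod.fst_add, Prod.snd_add, Prod.smul_fst, Prod.smul_snd, smul_eq_mul]
  congr 1
  push_cast
  ring

/-- If the generator applied to `expFun α β μ * (1 + k)` is `expFun α β μ * e`, then the expectation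
of `expFun α β μ` is close to `1` as soon as `k` and `e` are small. -/
lemma norm_integral_expFun_sub_one_le (M : PlanarMotion P lam p q) {c : ℝ} (hlam : 0 < lam) {t : ℝ}
    (ht : 0 ≤ t) (α β : ℝ) (μ : ℂ) (k e : ZMod 4 → ℂ)
    (hke : ∀ j, (Complex.I * (α * (vel c j).1 + β * (vel c j).2.1) - μ) * (1 + k j) +
      lam * (p * (1 + k (j + 1)) + q * (1 + k (j - 1)) + (1 - p - q) * (1 + k (j + 2))
        - (1 + k j)) = e j) :
    ‖∫ ω, expFun α β μ (M.state c t ω) ∂P - 1‖ ≤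
      Real.exp (‖μ‖ * t) * (∑ j, ‖k j‖) + (∑ j, ‖k j‖)
        + Real.exp (‖μ‖ * t) * (∑ j, ‖e j‖) * t := by
  set m := Real.exp (‖μ‖ * t) with hm
  set K := ∑ j, ‖k j‖ with hK
  have hkK : ∀ j, ‖k j‖ ≤ K := fun j =>
    Finset.single_le_sum (f := fun j => ‖k j‖) (fun _ _ => norm_nonneg _) (Finset.mem_univ j)
  have heE : ∀ j, ‖e j‖ ≤ ∑ j, ‖e j‖ := fun j =>
    Finset.single_le_sum (f := fun j => ‖e j‖) (fun _ _ => norm_nonneg _) (Finset.mem_univ j)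
  set G := expFun α β μ with hG
  have hGm : ∀ x ∈ strip t, ‖G x‖ ≤ m := fun x hx => norm_expFun_le hx
  set F : ZMod 4 → ℝ × ℝ × ℝ → ℂ := fun j x => G x * (1 + k j) with hF
  set a : ZMod 4 → ℂ := fun j => Complex.I * (α * (vel c j).1 + β * (vel c j).2.1) - μ with ha
  set F' : ZMod 4 → ℝ × ℝ × ℝ → ℂ := fun j x => a j * G x * (1 + k j) with hF'
  have hFc : ∀ j, Continuous (F j) := fun j => (continuous_expFun α β μ).mul continuous_const
  have hF'c : ∀ j, Continuous (F' j) := fun j =>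
    (continuous_const.mul (continuous_expFun α β μ)).mul continuous_const
  have hd : ∀ j x, HasLineDerivAt ℝ (F j) (F' j x) x (vel c j) := by
    intro j x
    have h := hasLineDerivAt_expFun α β μ x (vel c j)
    have hv : (vel c j).2.2 = 1 := rfl
    rw [hv, Complex.ofReal_one, mul_one] at h
    exact HasDerivAt.mul_const h (1 + k j)
  have hgen : ∀ j x, generator lam p q F F' j x = G x * e j := by
    intro j x
    rw [← hke j]
    simp only [generator, turnOp, hF, hF', ha, Complex.real_smul]
    push_cast
    ring
  have hk1 : ∀ j, ‖1 + k j‖ ≤ 1 + K := fun j =>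
    (norm_add_le _ _).trans (by rw [norm_one]; gcongr; exact hkK j)
  have hm0 : 0 ≤ m := (Real.exp_pos _).le
  have hK0 : 0 ≤ K := Finset.sum_nonneg fun _ _ => norm_nonneg _
  have hFb : ∀ j, ∀ x ∈ strip t, ‖F j x‖ ≤ m * (1 + K) := fun j x hx => by
    rw [hF, norm_mul]
    exact mul_le_mul (hGm x hx) (hk1 j) (norm_nonneg _) hm0
  have hF'b : ∀ j, ∀ x ∈ strip t, ‖F' j x‖ ≤ (∑ j, ‖a j‖) * (m * (1 + K)) := fun j x hx => by
    have h : F' j x = a j * F j x := mul_assoc _ _ _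
    rw [h, norm_mul]
    refine mul_le_mul ?_ (hFb j x hx) (norm_nonneg _) (Finset.sum_nonneg fun _ _ => norm_nonneg _)
    exact Finset.single_le_sum (f := fun j => ‖a j‖) (fun _ _ => norm_nonneg _) (Finset.mem_univ j)
  have key := M.dynkin hlam ht hFc hF'c hd
    (fun j x hx => (hFb j x hx).trans (le_max_left _ ((∑ j, ‖a j‖) * (m * (1 + K)))))
    (fun j x hx => (hF'b j x hx).trans (le_max_right _ _))
  have hst : ∀ ω τ, 0 ≤ τ → τ ≤ t → M.state c τ ω ∈ strip t := fun ω τ h1 h2 => ⟨h1, h2⟩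
  have mG : AEStronglyMeasurable (fun ω => G (M.state c t ω)) P :=
    ((continuous_expFun α β μ).measurable.comp_aemeasurable
      (M.aemeasurable_state hlam c ht)).aestronglyMeasurable
  have iG : Integrable (fun ω => G (M.state c t ω)) P :=
    Integrable.of_bound mG m (Eventually.of_forall fun ω => hGm _ (hst ω t ht le_rfl))
  have iGk : Integrable (fun ω => G (M.state c t ω) * k (M.D t ω)) P := by
    refine iG.mul_bdd (c := K) (M.aemeasurable_comp_D hlam ht k).aestronglyMeasurable ?_
    exact Eventually.of_forall fun ω => hkK _
  have e1 : ∫ ω, F (M.D t ω) (M.state c t ω) ∂P =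
      ∫ ω, G (M.state c t ω) ∂P + ∫ ω, G (M.state c t ω) * k (M.D t ω) ∂P := by
    rw [← integral_add iG iGk]
    congr 1
    ext ω
    simp only [hF]
    ring
  have e2 : ∫ ω, F (M.D₀ ω) 0 ∂P = 1 + ∫ ω, k (M.D₀ ω) ∂P := by
    have i0 : Integrable (fun ω => k (M.D₀ ω)) P := Integrable.of_bound
      ((measurable_of_countable k).comp M.measurable_D₀).aestronglyMeasurable K
      (Eventually.of_forall fun ω => hkK _)
    have h1 : ∫ _ : Ω, (1 : ℂ) ∂P = 1 := by simp
    rw [← h1, ← integral_add (integrable_const _) i0]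
    congr 1
    ext ω
    simp [hF, hG, expFun]
  have b1 : ‖∫ ω, G (M.state c t ω) * k (M.D t ω) ∂P‖ ≤ m * K := by
    refine (norm_integral_le_of_norm_le_const (Eventually.of_forall fun ω => ?_)).trans
      (by simp : m * K * P.real univ ≤ m * K)
    rw [norm_mul]
    exact mul_le_mul (hGm _ (hst ω t ht le_rfl)) (hkK _) (norm_nonneg _) hm0
  have b2 : ‖∫ ω, k (M.D₀ ω) ∂P‖ ≤ K :=
    (norm_integral_le_of_norm_le_const (Eventually.of_forall fun ω => hkK _)).trans
      (by simp : K * P.real univ ≤ K)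
  have b3 : ‖∫ ω, (∫ τ in (0 : ℝ)..t, generator lam p q F F' (M.D τ ω) (M.state c τ ω)) ∂P‖ ≤
      m * (∑ j, ‖e j‖) * t := by
    refine (norm_integral_le_of_norm_le_const (Eventually.of_forall fun ω => ?_)).trans
      (by simp : m * (∑ j, ‖e j‖) * t * P.real univ ≤ m * (∑ j, ‖e j‖) * t)
    refine (intervalIntegral.norm_integral_le_of_norm_le_const (C := m * (∑ j, ‖e j‖))
      fun τ hτ => ?_).trans (by rw [sub_zero, abs_of_nonneg ht])
    rw [Set.uIoc_of_le ht] at hτ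
    rw [hgen, norm_mul]
    exact mul_le_mul (hGm _ (hst ω τ hτ.1.le hτ.2)) (heE _) (norm_nonneg _) hm0
  rw [e1, e2] at key
  -- Dynkin's formula for `F j = G * (1 + k j)`, with the contribution of `k` isolated
  have e3 : ∫ ω, G (M.state c t ω) ∂P - 1 = -(∫ ω, G (M.state c t ω) * k (M.D t ω) ∂P) +
      ∫ ω, k (M.D₀ ω) ∂P +
      ∫ ω, (∫ τ in (0 : ℝ)..t, generator lam p q F F' (M.D τ ω) (M.state c τ ω)) ∂P := by
    linear_combination key
  rw [e3]
  refine (norm_add₃_le).trans ?_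
  rw [norm_neg]
  exact add_le_add (add_le_add b1 b2) b3

end PlanarMotion

/-! ### Convergence of the characteristic functions -/

namespace PlanarMotion

/-- The perturbation `k` of the exponential which makes the generator small. Its terms `A` and `B`,
odd under reversal of the direction, compensate the fast motion along the `y`-axis, and its even
term `C` averages over the vertical and the horizontal directions. The value of `μ` is forced by the
vanishing of the terms of order `1`. -/
lemma generator_corrector {lam c p q α β : ℝ} {A B C μ : ℂ}
    (hB : (2 - (p + q)) * B = (p - q) * A) (hC : 2 * lam * (p + q) * C = μ)
    (hA : lam * ((p - q) * B + (2 - (p + q)) * A) = Complex.I * (β * c))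
    (hμ : 2 * μ = Complex.I * α + Complex.I * (β * c) * A) (j : ZMod 4) :
    let k : ZMod 4 → ℂ := ![B - C, A + C, -B - C, -A + C]
    let e : ZMod 4 → ℂ := ![-μ * (B - C), (Complex.I * α - μ) * (A + C) + Complex.I * β * (c * C),
      μ * (B + C), (Complex.I * α - μ) * (-A + C) - Complex.I * β * (c * C)]
    (Complex.I * (α * (vel c j).1 + β * (vel c j).2.1) - μ) * (1 + k j) +
      lam * (p * (1 + k (j + 1)) + q * (1 + k (j - 1)) + (1 - p - q) * (1 + k (j + 2))
        - (1 + k j)) = e j := by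
  intro k e
  obtain ⟨v0, v1, v2, v3⟩ := vel_values c
  have k0 : k 0 = B - C := rfl
  have k1 : k 1 = A + C := rfl
  have k2 : k 2 = -B - C := rfl
  have k3 : k 3 = -A + C := rfl
  have e0 : e 0 = -μ * (B - C) := rfl
  have e1 : e 1 = (Complex.I * α - μ) * (A + C) + Complex.I * β * (c * C) := rfl
  have e2 : e 2 = μ * (B + C) := rfl
  have e3 : e 3 = (Complex.I * α - μ) * (-A + C) - Complex.I * β * (c * C) := rfl
  have hj : ∀ j : ZMod 4, j = 0 ∨ j = 1 ∨ j = 2 ∨ j = 3 := by decide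
  have a0 : (0 : ZMod 4) + 1 = 1 ∧ (0 : ZMod 4) - 1 = 3 ∧ (0 : ZMod 4) + 2 = 2 := by decide
  have a1 : (1 : ZMod 4) + 1 = 2 ∧ (1 : ZMod 4) - 1 = 0 ∧ (1 : ZMod 4) + 2 = 3 := by decide
  have a2 : (2 : ZMod 4) + 1 = 3 ∧ (2 : ZMod 4) - 1 = 1 ∧ (2 : ZMod 4) + 2 = 0 := by decide
  have a3 : (3 : ZMod 4) + 1 = 0 ∧ (3 : ZMod 4) - 1 = 2 ∧ (3 : ZMod 4) + 2 = 1 := by decide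
  rcases hj j with rfl | rfl | rfl | rfl
  · rw [a0.1, a0.2.1, a0.2.2, v0, k0, k1, k2, k3, e0]
    push_cast
    linear_combination -lam * hB + hC
  · rw [a1.1, a1.2.1, a1.2.2, v1, k0, k1, k2, k3, e1]
    push_cast
    linear_combination -hμ - hA - hC
  · rw [a2.1, a2.2.1, a2.2.2, v2, k0, k1, k2, k3, e2]
    push_cast
    linear_combination lam * hB + hC
  · rw [a3.1, a3.2.1, a3.2.2, v3, k0, k1, k2, k3, e3]
    push_cast
    linear_combination -hμ + hA - hC

section Limit

variable {p q : ℝ} {lam c : ℕ → ℝ} {Ω : ℕ → Type*} [∀ n, MeasurableSpace (Ω n)]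
  {P : ∀ n, Measure (Ω n)} [∀ n, IsProbabilityMeasure (P n)]

/-- The characteristic functions of `(T(t), Y(t))` converge. -/
lemma tendsto_integral_cexp (M : ∀ n, PlanarMotion (P n) (lam n) p q)
    (hpq : p + q ≤ 1) (hpos : 0 < p + q) (hlam : ∀ n, 0 < lam n)
    (hlam_top : Tendsto lam atTop atTop) (hc : ∀ n, 0 < c n) (hc_top : Tendsto c atTop atTop)
    (hratio : Tendsto (fun n => lam n / c n ^ 2) atTop (𝓝 1)) {t : ℝ} (ht : 0 ≤ t) (α β : ℝ) :
    Tendsto (fun n => ∫ ω, Complex.exp (Complex.I * (α * (M n).T t ω + β * (M n).Y (c n) t ω))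
      ∂(P n)) atTop
      (𝓝 (Complex.exp ((Complex.I * α / 2 - diffCoeff p q * β ^ 2) * t))) := by
  have hS : (1 - p) ^ 2 + (1 - q) ^ 2 ≠ 0 := (sq_one_sub_add_sq_one_sub_pos hpq).ne'
  have hS' : (1 - p : ℂ) ^ 2 + (1 - q) ^ 2 ≠ 0 := mod_cast hS
  have ha : (p + q : ℂ) ≠ 0 := mod_cast hpos.ne'
  have h2a : (2 - (p + q) : ℂ) ≠ 0 := by
    have : 2 - (p + q) ≠ 0 := by linarith
    exact_mod_cast this
  set σ := diffCoeff p q with hσ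
  -- the identity that makes `σ` the diffusion coefficient
  have hσS : (4 * σ * ((1 - p) ^ 2 + (1 - q) ^ 2) : ℂ) = 2 - (p + q) := by
    have : 4 * σ * ((1 - p) ^ 2 + (1 - q) ^ 2) = 2 - (p + q) := by
      rw [hσ, diffCoeff]
      field_simp
      ring
    exact_mod_cast this
  have hl : ∀ n, (lam n : ℂ) ≠ 0 := fun n => mod_cast (hlam n).ne'
  set μ : ℕ → ℂ := fun n => Complex.I * α / 2 - σ * β ^ 2 * ((c n ^ 2 / lam n : ℝ) : ℂ) with hμ
  set A : ℕ → ℂ := fun n => 2 * σ * Complex.I * β * ((c n / lam n : ℝ) : ℂ) with hA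
  set B : ℕ → ℂ := fun n => (p - q) / (2 - (p + q)) * A n with hB
  set C : ℕ → ℂ := fun n => μ n / (2 * (p + q)) * (((lam n)⁻¹ : ℝ) : ℂ) with hC
  have hx2 : Tendsto (fun n => c n ^ 2 / lam n) atTop (𝓝 1) := by
    simpa using hratio.inv₀ one_ne_zero
  -- `c / lam = (c ^ 2 / lam) / c`
  have hx1 : Tendsto (fun n => c n / lam n) atTop (𝓝 0) := by
    have h := hx2.mul hc_top.inv_tendsto_atTop
    rw [mul_zero] at h
    refine h.congr fun n => ?_
    have := (hc n).ne'
    have := (hlam n).ne'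
    simp only [Pi.inv_apply]
    field_simp
  have hx0 : Tendsto (fun n => (lam n)⁻¹) atTop (𝓝 0) := hlam_top.inv_tendsto_atTop
  have hcast : ∀ {f : ℕ → ℝ} {a : ℝ}, Tendsto f atTop (𝓝 a) →
      Tendsto (fun n => ((f n : ℝ) : ℂ)) atTop (𝓝 ((a : ℝ) : ℂ)) := fun h =>
    (Complex.continuous_ofReal.tendsto _).comp h
  have tμ : Tendsto μ atTop (𝓝 (Complex.I * α / 2 - σ * β ^ 2)) := by
    have h := ((hcast hx2).const_mul (σ * β ^ 2 : ℂ)).const_sub (Complex.I * α / 2)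
    rwa [Complex.ofReal_one, mul_one] at h
  have tA : Tendsto A atTop (𝓝 0) := by
    have h := (hcast hx1).const_mul (2 * σ * Complex.I * β : ℂ)
    rwa [Complex.ofReal_zero, mul_zero] at h
  have tB : Tendsto B atTop (𝓝 0) := by
    have h := tA.const_mul ((p - q) / (2 - (p + q)) : ℂ)
    rwa [mul_zero] at h
  have tC : Tendsto C atTop (𝓝 0) := by
    have h := (tμ.div_const (2 * (p + q) : ℂ)).mul (hcast hx0)
    rwa [Complex.ofReal_zero, mul_zero] at h
  -- `c * C` stays small although `c` tends to infinity, as `C` is of order `lam⁻¹`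
  have tcC : Tendsto (fun n => (c n : ℂ) * C n) atTop (𝓝 0) := by
    have h := (tμ.div_const (2 * (p + q) : ℂ)).mul (hcast hx1)
    rw [Complex.ofReal_zero, mul_zero] at h
    refine h.congr fun n => ?_
    simp only [hC]
    push_cast
    ring
  set k : ℕ → ZMod 4 → ℂ := fun n => ![B n - C n, A n + C n, -B n - C n, -A n + C n] with hk
  set e : ℕ → ZMod 4 → ℂ := fun n => ![-μ n * (B n - C n),
    (Complex.I * α - μ n) * (A n + C n) + Complex.I * β * (c n * C n), μ n * (B n + C n),
    (Complex.I * α - μ n) * (-A n + C n) - Complex.I * β * (c n * C n)] with he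
  have hj : ∀ j : ZMod 4, j = 0 ∨ j = 1 ∨ j = 2 ∨ j = 3 := by decide
  have h0 : ∀ {f : ℕ → ℂ} {a : ℂ}, a = 0 → Tendsto f atTop (𝓝 a) → Tendsto f atTop (𝓝 0) :=
    fun h hf => h ▸ hf
  have tk : ∀ j, Tendsto (fun n => k n j) atTop (𝓝 0) := by
    intro j
    rcases hj j with rfl | rfl | rfl | rfl
    · exact h0 (by simp) (tB.sub tC)
    · exact h0 (by simp) (tA.add tC)
    · exact h0 (by simp) (tB.neg.sub tC)
    · exact h0 (by simp) (tA.neg.add tC)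
  have te : ∀ j, Tendsto (fun n => e n j) atTop (𝓝 0) := by
    intro j
    rcases hj j with rfl | rfl | rfl | rfl
    · exact h0 (by simp) ( tμ.neg.mul (tB.sub tC))
    · exact h0 (by simp) ( ((tμ.const_sub (Complex.I * α)).mul (tA.add tC)).add
        (tcC.const_mul (Complex.I * β)))
    · exact h0 (by simp) ( tμ.mul (tB.add tC))
    · exact h0 (by simp) ( ((tμ.const_sub (Complex.I * α)).mul (tA.neg.add tC)).sub
        (tcC.const_mul (Complex.I * β)))
  have tsum : ∀ {f : ℕ → ZMod 4 → ℂ}, (∀ j, Tendsto (fun n => f n j) atTop (𝓝 0)) →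
      Tendsto (fun n => ∑ j, ‖f n j‖) atTop (𝓝 0) := by
    intro f hf
    have h := tendsto_finsetSum (Finset.univ : Finset (ZMod 4)) fun j _ => (hf j).norm
    simpa using h
  have tm : Tendsto (fun n => Real.exp (‖μ n‖ * t)) atTop
      (𝓝 (Real.exp (‖Complex.I * α / 2 - σ * β ^ 2‖ * t))) :=
    (Real.continuous_exp.tendsto _).comp (tμ.norm.mul_const t)
  have tbound : Tendsto (fun n => Real.exp (‖μ n‖ * t) * (∑ j, ‖k n j‖) + (∑ j, ‖k n j‖)
      + Real.exp (‖μ n‖ * t) * (∑ j, ‖e n j‖) * t) atTop (𝓝 0) := by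
    simpa using ((tm.mul (tsum tk)).add (tsum tk)).add ((tm.mul (tsum te)).mul_const t)
  have t1 : Tendsto (fun n => ∫ ω, expFun α β (μ n) ((M n).state (c n) t ω) ∂(P n)) atTop
      (𝓝 1) := by
    rw [tendsto_iff_norm_sub_tendsto_zero]
    refine squeeze_zero (fun _ => norm_nonneg _) (fun n => ?_) tbound
    refine (M n).norm_integral_expFun_sub_one_le (hlam n) ht α β (μ n) (k n) (e n) ?_
    have hBn : (2 - (p + q)) * B n = (p - q) * A n := by
      simp only [hB]
      field_simp
    refine generator_corrector hBn ?_ ?_ ?_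
    · simp only [hC]
      push_cast
      have := hl n
      field_simp
    · have h2 : (2 - (p + q) : ℂ) * (lam n * ((p - q) * B n + (2 - (p + q)) * A n)) =
          (2 - (p + q)) * (Complex.I * (β * c n)) := by
        have h3 : (lam n : ℂ) * A n = 2 * σ * Complex.I * β * c n := by
          simp only [hA]
          push_cast
          have := hl n
          field_simp
        linear_combination lam n * (p - q) * hBn + ((p - q) ^ 2 + (2 - (p + q)) ^ 2) * h3 +
          Complex.I * β * c n * hσS
      exact mul_left_cancel₀ h2a h2
    · simp only [hμ, hA]
      push_cast
      linear_combination (-2 * σ * β ^ 2 * (c n ^ 2 / lam n) : ℂ) * Complex.I_sq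
  have t2 : Tendsto (fun n => Complex.exp (μ n * t)) atTop
      (𝓝 (Complex.exp ((Complex.I * α / 2 - σ * β ^ 2) * t))) :=
    (Complex.continuous_exp.tendsto _).comp (tμ.mul_const _)
  have h := t1.mul t2
  rw [one_mul] at h
  refine h.congr fun n => ?_
  rw [← integral_mul_const]
  congr 1
  ext ω
  rw [expFun, ← Complex.exp_add]
  congr 1
  simp only [state]
  ring

end Limit

end PlanarMotion

/-! ### Convergence in distribution and in probability -/

lemma diffCoeff_nonneg {p q : ℝ} (hpq : p + q ≤ 1) : 0 ≤ diffCoeff p q := by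
  have h := sq_one_sub_add_sq_one_sub_pos hpq
  have h' : 0 ≤ (1 - p) + (1 - q) := by linarith
  unfold diffCoeff
  positivity

namespace PlanarMotion

variable {p q : ℝ} {lam c : ℕ → ℝ} {Ω : ℕ → Type*} [∀ n, MeasurableSpace (Ω n)]
  {P : ∀ n, Measure (Ω n)} [∀ n, IsProbabilityMeasure (P n)]

/-- `(T(t), Y(t))` converges in distribution, by Lévy's continuity theorem. -/
theorem tendstoInDistribution (M : ∀ n, PlanarMotion (P n) (lam n) p q)
    (hpq : p + q ≤ 1) (hpos : 0 < p + q) (hlam : ∀ n, 0 < lam n)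
    (hlam_top : Tendsto lam atTop atTop) (hc : ∀ n, 0 < c n) (hc_top : Tendsto c atTop atTop)
    (hratio : Tendsto (fun n => lam n / c n ^ 2) atTop (𝓝 1)) {t : ℝ} (ht : 0 ≤ t) :
    TendstoInDistribution (fun n ω => ((M n).T t ω, (M n).Y (c n) t ω)) atTop
      (fun z : ℝ => (t / 2, z)) P (limitLaw p q t) := by
  have mX : ∀ n, AEMeasurable (fun ω => ((M n).T t ω, (M n).Y (c n) t ω)) (P n) := fun n =>
    (measurable_fst.prodMk (measurable_fst.comp measurable_snd)).comp_aemeasurable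
      ((M n).aemeasurable_state (hlam n) (c n) ht)
  -- Lévy's theorem is stated in inner product spaces, hence the Euclidean norm on the plane
  have key : TendstoInDistribution
      (fun n ω => WithLp.toLp 2 ((M n).T t ω, (M n).Y (c n) t ω)) atTop
      (fun z : ℝ => WithLp.toLp 2 (t / 2, z)) P (limitLaw p q t) := by
    have mX' : ∀ n, AEMeasurable (fun ω => WithLp.toLp 2 ((M n).T t ω, (M n).Y (c n) t ω))
      (P n) := fun n => (WithLp.prod_continuous_toLp 2 ℝ ℝ).measurable.comp_aemeasurable (mX n)
    have mZ : Continuous (fun z : ℝ => WithLp.toLp 2 (t / 2, z)) :=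
      (WithLp.prod_continuous_toLp 2 ℝ ℝ).comp (by fun_prop)
    refine ⟨mX', mZ.aemeasurable, ?_⟩
    refine ProbabilityMeasure.tendsto_of_tendsto_charFun fun x => ?_
    have h := tendsto_integral_cexp M hpq hpos hlam hlam_top hc hc_top hratio ht x.fst x.snd
    have e1 : charFun ((limitLaw p q t).map fun z : ℝ => WithLp.toLp 2 (t / 2, z)) x =
        Complex.exp ((Complex.I * x.fst / 2 - diffCoeff p q * x.snd ^ 2) * t) := by
      rw [charFun_apply, integral_map mZ.aemeasurable (by fun_prop)]
      have hσ : 0 ≤ 2 * diffCoeff p q * t :=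
        mul_nonneg (mul_nonneg zero_le_two (diffCoeff_nonneg hpq)) ht
      have h2 := charFun_gaussianReal (μ := 0) (v := (2 * diffCoeff p q * t).toNNReal) x.snd
      rw [charFun_apply_real, Real.coe_toNNReal _ hσ] at h2
      have e2 : ∀ z : ℝ, Complex.exp (inner ℝ (WithLp.toLp 2 (t / 2, z)) x * Complex.I) =
          Complex.exp (Complex.I * x.fst / 2 * t) * Complex.exp (x.snd * z * Complex.I) := by
        intro z
        rw [← Complex.exp_add]
        congr 1
        simp only [WithLp.prod_inner_apply, RCLike.inner_apply, conj_trivial, WithLp.fst,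
          WithLp.snd]
        push_cast
        ring
      simp_rw [e2]
      rw [integral_const_mul, limitLaw, h2, ← Complex.exp_add]
      congr 1
      push_cast
      ring
    simp only [ProbabilityMeasure.coe_mk]
    rw [e1]
    refine h.congr fun n => ?_
    rw [charFun_apply, integral_map (mX' n) (by fun_prop)]
    congr 1
    ext ω
    congr 1
    simp only [WithLp.prod_inner_apply, RCLike.inner_apply, conj_trivial, WithLp.fst, WithLp.snd]
    push_cast
    ring
  exact key.continuous_comp (g := WithLp.ofLp) (WithLp.prod_continuous_ofLp 2 ℝ ℝ)

/-- Convergence in distribution to a pair with deterministic first component gives convergence in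
probability of the first component. -/
theorem tendsto_measureReal_T (M : ∀ n, PlanarMotion (P n) (lam n) p q) {t : ℝ}
    (h : TendstoInDistribution (fun n ω => ((M n).T t ω, (M n).Y (c n) t ω)) atTop
      (fun z : ℝ => (t / 2, z)) P (limitLaw p q t)) {ε : ℝ} (hε : 0 < ε) :
    Tendsto (fun n => (P n).real {ω | ε ≤ |(M n).T t ω - t / 2|}) atTop (𝓝 0) := by
  -- the closed set `{(s, y) | ε ≤ |s - t / 2|}` is a null set for the limit law
  set F : Set (ℝ × ℝ) := {x | ε ≤ |x.1 - t / 2|} with hF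
  have hFc : IsClosed F := isClosed_le continuous_const (by fun_prop)
  have h1 : frontier F ⊆ F := hFc.frontier_subset
  have h0 : (limitLaw p q t).map (fun z : ℝ => (t / 2, z)) F = 0 := by
    rw [Measure.map_apply_of_aemeasurable h.aemeasurable_limit hFc.measurableSet]
    simp [hF, hε.not_ge]
  have h2 := ProbabilityMeasure.tendsto_measure_of_null_frontier_of_tendsto' h.tendsto (E := F)
    (measure_mono_null h1 h0)
  simp only [ProbabilityMeasure.coe_mk, h0] at h2
  have h3 := (ENNReal.tendsto_toReal ENNReal.zero_ne_top).comp h2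
  refine h3.congr fun n => ?_
  simp only [Function.comp_apply]
  rw [Measure.map_apply_of_aemeasurable (h.forall_aemeasurable n) hFc.measurableSet]
  rfl

end PlanarMotion

/-! ### Convergence of the joint densities -/

/-- The distribution `δ(s - t/2) ⊗ N(0, 2 diffCoeff p q t)(dy)` on `{t > 0}`. -/
lemma exists_limit_distribution {p q : ℝ} (hpq : p + q ≤ 1) :
    ∃ u : 𝓓'(halfSpace, ℝ), ∀ φ : 𝓓(halfSpace, ℝ),
      u φ = ∫ t in Ioi (0 : ℝ), ∫ y, φ (t / 2, y, t) ∂(limitLaw p q t) := by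
  -- the law at time `t` is the image of the standard Gaussian law under a dilation
  have hZ : Continuous fun z : ℝ × ℝ =>
      (z.1 / 2, Real.sqrt (2 * diffCoeff p q * z.1) * z.2, z.1) := by fun_prop
  obtain ⟨u, hu⟩ := exists_distribution (P := gaussianReal 0 1)
    (Z := fun t x => (t / 2, Real.sqrt (2 * diffCoeff p q * t) * x, t))
    hZ.measurable.aemeasurable (fun _ _ => rfl)
  refine ⟨u, fun φ => (hu φ).trans (setIntegral_congr_fun measurableSet_Ioi fun t ht => ?_)⟩
  have hσ : 0 ≤ 2 * diffCoeff p q * t :=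
    mul_nonneg (mul_nonneg zero_le_two (diffCoeff_nonneg hpq)) (le_of_lt ht)
  have hmap : (gaussianReal 0 1).map (Real.sqrt (2 * diffCoeff p q * t) * ·) = limitLaw p q t := by
    rw [gaussianReal_map_const_mul, mul_zero, mul_one, limitLaw]
    congr 1
    ext
    simp [Real.sq_sqrt hσ, hσ]
  change _ = ∫ y, φ (t / 2, y, t) ∂(limitLaw p q t)
  rw [← hmap, integral_map (by fun_prop)]
  exact (φ.continuous.comp (by fun_prop)).aestronglyMeasurable

/-- The joint densities converge as distributions: for each `t` the inner integrals converge by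
convergence in distribution, and the outer one by domination, `φ` being bounded and vanishing for
large `t`. -/
lemma tendsto_jointDensity {p q : ℝ} {lam c : ℕ → ℝ} {Ω : ℕ → Type*} [∀ n, MeasurableSpace (Ω n)]
    {P : ∀ n, Measure (Ω n)} [∀ n, IsProbabilityMeasure (P n)]
    (M : ∀ n, PlanarMotion (P n) (lam n) p q) (hlam : ∀ n, 0 < lam n)
    (h : ∀ t : ℝ, 0 < t →
      TendstoInDistribution (fun n ω => ((M n).T t ω, (M n).Y (c n) t ω)) atTop
        (fun z : ℝ => (t / 2, z)) P (limitLaw p q t)) (φ : 𝓓(halfSpace, ℝ)) :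
    Tendsto (fun n => ∫ t in Ioi (0 : ℝ), ∫ ω, φ ((M n).T t ω, (M n).Y (c n) t ω, t) ∂(P n)) atTop
      (𝓝 (∫ t in Ioi (0 : ℝ), ∫ y, φ (t / 2, y, t) ∂(limitLaw p q t))) := by
  obtain ⟨C, hC⟩ := φ.hasCompactSupport.exists_bound_of_continuous φ.continuous
  obtain ⟨R, hR⟩ := (eventually_testFunction_eq_zero φ).exists
  refine tendsto_integral_of_dominated_convergence ((Iic R).indicator fun _ => C) (fun n => ?_) ?_
    (fun n => ?_) ?_
  · exact (integrable_testFunction_comp ((M n).aemeasurable_uncurry_state (hlam n) (c n)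
      (ae_restrict_of_forall_mem measurableSet_Ioi fun t ht => le_of_lt ht)) (fun _ _ => rfl)
      φ).integral_prod_left.aestronglyMeasurable
  · rw [integrable_indicator_iff measurableSet_Iic, IntegrableOn,
      Measure.restrict_restrict measurableSet_Iic, Iic_inter_Ioi]
    exact integrableOn_const (by simp)
  · refine Eventually.of_forall fun t => ?_
    by_cases ht : t ≤ R
    · rw [indicator_of_mem (s := Iic R) ht]
      exact (norm_integral_le_of_norm_le_const (Eventually.of_forall fun ω => hC _)).trans
        (by simp : C * (P n).real univ ≤ C)
    · rw [indicator_of_notMem (s := Iic R) ht]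
      have h0 : ∀ ω, φ ((M n).T t ω, (M n).Y (c n) t ω, t) = 0 := fun ω => hR _ (le_of_not_ge ht)
      simp [h0]
  · refine ae_restrict_of_forall_mem measurableSet_Ioi fun t ht => ?_
    have hφ : Continuous fun x : ℝ × ℝ => φ (x.1, x.2, t) := φ.continuous.comp (by fun_prop)
    let g : BoundedContinuousFunction (ℝ × ℝ) ℝ :=
      BoundedContinuousFunction.ofNormedAddCommGroup _ hφ C fun x => hC _
    have h1 := (ProbabilityMeasure.tendsto_iff_forall_integral_tendsto.1 (h t ht).tendsto) g
    simp only [ProbabilityMeasure.coe_mk] at h1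
    rw [integral_map (h t ht).aemeasurable_limit (by fun_prop)] at h1
    refine h1.congr fun n => ?_
    rw [integral_map ((h t ht).forall_aemeasurable n) (by fun_prop)]
    rfl

end

theorem mainTheorem2 (p q : ℝ) (hp : 0 ≤ p) (hq : 0 ≤ q) (hpq : p + q ≤ 1) (hpos : 0 < p + q)
    (lam c : ℕ → ℝ) (hlam : ∀ n, 0 < lam n) (hc : ∀ n, 0 < c n)
    (hlam_top : Tendsto lam atTop atTop) (hc_top : Tendsto c atTop atTop)
    (hratio : Tendsto (fun n => lam n / c n ^ 2) atTop (𝓝 1))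
    (Ω : ℕ → Type*) [∀ n, MeasurableSpace (Ω n)]
    (P : ∀ n, Measure (Ω n)) [∀ n, IsProbabilityMeasure (P n)]
    (M : ∀ n, PlanarMotion (P n) (lam n) p q) :
    -- the operator of the fourth-order equation, divided by `λ³`, becomes a positive multiple
    -- of the operator of the limiting equation
    (∀ (U : Opens (ℝ × ℝ × ℝ)) (v : ℕ → 𝓓'(U, ℝ)) (u : 𝓓'(U, ℝ)),
      (∀ φ : 𝓓(U, ℝ), Tendsto (fun n => v n φ) atTop (𝓝 (u φ))) →
      ∀ φ : 𝓓(U, ℝ),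
        Tendsto (fun n => (lam n ^ 3)⁻¹ * jointOp U (lam n) (c n) p q (v n) φ) atTop
          (𝓝 (4 * (p + q) * ((1 - p) ^ 2 + (1 - q) ^ 2) *
            (Dt U u + (1 / 2 : ℝ) • Ds U u - diffCoeff p q • Dy U (Dy U u)) φ))) ∧
    -- limits of solutions of the fourth-order equation solve the limiting equation
    (∀ (U : Opens (ℝ × ℝ × ℝ)) (v : ℕ → 𝓓'(U, ℝ)) (u : 𝓓'(U, ℝ)),
      (∀ n, jointOp U (lam n) (c n) p q (v n) = 0) →
      (∀ φ : 𝓓(U, ℝ), Tendsto (fun n => v n φ) atTop (𝓝 (u φ))) →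
      LimitEq U p q u) ∧
    -- the joint densities of `(T(t), Y(t))` solve the fourth-order equation, and they converge to
    -- the solution `δ(s - t/2) ⊗ N(0, 2 diffCoeff p q t)(dy)` of the limiting equation
    (∃ (ubar : ℕ → 𝓓'(halfSpace, ℝ)) (u : 𝓓'(halfSpace, ℝ)),
      (∀ n, IsJointDensity (M n) (c n) (ubar n)) ∧
      (∀ n, jointOp halfSpace (lam n) (c n) p q (ubar n) = 0) ∧
      (∀ φ : 𝓓(halfSpace, ℝ), Tendsto (fun n => ubar n φ) atTop (𝓝 (u φ))) ∧
      (∀ φ : 𝓓(halfSpace, ℝ),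
        u φ = ∫ t in Ioi (0 : ℝ), ∫ y, φ (t / 2, y, t) ∂(limitLaw p q t)) ∧
      LimitEq halfSpace p q u) ∧
    -- `T(t) → t/2` in probability: in the limit half of the time is spent moving vertically
    (∀ t : ℝ, 0 < t → ∀ ε : ℝ, 0 < ε →
      Tendsto (fun n => (P n).real {ω | ε ≤ |(M n).T t ω - t / 2|}) atTop (𝓝 0)) ∧
    -- `(T(t), Y(t))` converges in distribution to `(t/2, Z)` with `Z` Gaussian
    (∀ t : ℝ, 0 < t →
      TendstoInDistribution (fun n ω => ((M n).T t ω, (M n).Y (c n) t ω)) atTop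
        (fun z : ℝ => (t / 2, z)) P (limitLaw p q t)) := by
  have h5 : ∀ t : ℝ, 0 < t → TendstoInDistribution
      (fun n ω => ((M n).T t ω, (M n).Y (c n) t ω)) atTop (fun z : ℝ => (t / 2, z)) P
      (limitLaw p q t) := fun t ht =>
    PlanarMotion.tendstoInDistribution M hpq hpos hlam hlam_top hc hc_top hratio ht.le
  refine ⟨fun U v u hv φ => tendsto_jointOp hpq hlam hlam_top hratio v u hv φ,
    fun U v u hv₀ hv => limitEq_of_tendsto hpq hpos hlam hlam_top hratio v u hv₀ hv, ?_,
    fun t ht ε hε => PlanarMotion.tendsto_measureReal_T M (h5 t ht) hε, h5⟩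
  choose ubar hubar using fun n => exists_distribution (P := P n) (Z := (M n).state (c n))
    ((M n).aemeasurable_uncurry_state (hlam n) (c n)
      (ae_restrict_of_forall_mem measurableSet_Ioi fun _ ht => le_of_lt ht)) (fun _ _ => rfl)
  obtain ⟨u, hu⟩ := exists_limit_distribution hpq
  have heq : ∀ n, jointOp halfSpace (lam n) (c n) p q (ubar n) = 0 := fun n =>
    jointOp_eq_zero (M n) (hlam n) (hubar n)
  have hlim : ∀ φ : 𝓓(halfSpace, ℝ), Tendsto (fun n => ubar n φ) atTop (𝓝 (u φ)) := by
    intro φ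
    rw [hu]
    exact (tendsto_jointDensity M hlam h5 φ).congr fun n => (hubar n φ).symm
  exact ⟨ubar, u, hubar, heq, hlim, hu,
    limitEq_of_tendsto hpq hpos hlam hlam_top hratio ubar u heq hlim⟩
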